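/- Let $\mathbb{K}$ be a field, let $V$ be a $\mathbb{K}$-vector space of finite dimension $\ell \ge 3$, and let $S=\mathrm{Sym}^*(V^*)\cong\mathbb{K}[x_1,\dots,x_\ell]$. For a central hyperplane arrangement $\mathcal{A}$ in $V$, that is, a finite (possibly empty) set of hyperplanes $L=\ker\alpha_L$ with $0\neq\alpha_L\in V^*$, let $$D(\mathcal{A})=\{\theta\in\mathrm{Der}_{\mathbb{K}}(S)\mid \theta(\alpha_L)\in S\alpha_L \text{ for all } L\in\mathcal{A}\}$$ be the graded $S$-module of logarithmic derivations, where $\theta$ is homogeneous of degree $d$ if $\theta(\alpha)$ is homogeneous of degree $d$ for all $\alpha\in V^*$. Let $g(\mathcal{A})$ be the minimal number of generators of the $S$-module $D(\mathcal{A})$. The arrangement $\mathcal{A}$ is called free if $D(\mathcal{A})$ is isomorphic as a graded $S$-module to $\bigoplus_{i=1}^{\ell}S[-d_i]$ for some integers $d_1,\dots,d_\ell\ge 0$, i.e. if it has an $S$-basis of $\ell$ homogeneous derivations. The same definitions are used for arrangements in any finite-dimensional vector space, with its dimension in place of $\ell$. Let $\mathcal{A}$ be a central hyperplane arrangement in $V$,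 let $H\in\mathcal{A}$, let $\mathcal{A}'=\mathcal{A}\setminus\{H\}$, and let $\mathcal{A}^H=\{H\cap L\mid L\in\mathcal{A}'\}$, an arrangement in the $(\ell-1)$-dimensional vector space $H$. If $\mathcal{A}'$ is free and $g(\mathcal{A})\le\ell+2$, then $\mathcal{A}^H$ is free. -/

import Mathlib

open Module

noncomputable section

/-- A central hyperplane arrangement in a `K`-vector space `V`: a finite set of hyperplanes, each of
which is the zero locus of a non-zero linear form. The empty arrangement is allowed. -/
structure HyperplaneArrangement (K V : Type*) [Field K] [AddCommGroup V] [Module K V] where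
  /-- the set of hyperplanes -/
  hyperplanes : Set (Submodule K V)
  finite : hyperplanes.Finite
  exists_form : ∀ L ∈ hyperplanes, ∃ α : Dual K V, α ≠ 0 ∧ L = LinearMap.ker α

/-- The coordinate ring `S = Sym(V*)`. -/
abbrev CoordRing (K V : Type*) [Field K] [AddCommGroup V] [Module K V] : Type _ :=
  SymmetricAlgebra K (Dual K V)

namespace HyperplaneArrangement

variable {K V : Type*} [Field K] [AddCommGroup V] [Module K V]

/-- The deletion `𝒜 \ {H}`. -/
def deletion (A : HyperplaneArrangement K V) (H : Submodule K V) : HyperplaneArrangement K V where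
  hyperplanes := A.hyperplanes \ {H}
  finite := A.finite.subset Set.sdiff_subset
  exists_form L hL := A.exists_form L hL.1

/-- Two hyperplanes one of which contains the other are equal. -/
lemma eq_of_le (A : HyperplaneArrangement K V) {H L : Submodule K V} (hH : H ∈ A.hyperplanes)
    (hL : L ∈ A.hyperplanes) (h : H ≤ L) : H = L := by
  obtain ⟨α, hα, rfl⟩ := A.exists_form H hH
  obtain ⟨β, hβ, rfl⟩ := A.exists_form L hL
  have h1 : IsCoatom (LinearMap.ker α) :=
    LinearMap.isCoatom_ker_of_surjective (LinearMap.surjective hα)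
  refine ((h1.le_iff).1 h).resolve_left ?_ |>.symm
  rwa [LinearMap.ker_eq_top]

/-- The restriction `𝒜^H = {H ∩ L | L ∈ 𝒜 \ {H}}`, an arrangement in the vector space `H`.
(`L.comap H.subtype` is `H ∩ L`, regarded as a subspace of `H`.) -/
def restriction (A : HyperplaneArrangement K V) (H : Submodule K V) (hH : H ∈ A.hyperplanes) :
    HyperplaneArrangement K H where
  hyperplanes := (fun L : Submodule K V => L.comap H.subtype) '' (A.deletion H).hyperplanes
  finite := (A.deletion H).finite.image _
  exists_form := by
    rintro _ ⟨L, hL, rfl⟩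
    obtain ⟨β, hβ, hLβ⟩ := A.exists_form L hL.1
    refine ⟨β ∘ₗ H.subtype, fun h0 => hL.2 ?_, ?_⟩
    · refine (A.eq_of_le hH hL.1 fun x hx => ?_).symm
      rw [hLβ]
      exact LinearMap.congr_fun h0 ⟨x, hx⟩
    · rw [LinearMap.ker_comp, hLβ]

/-- The logarithmic derivation module
`D(𝒜) = {θ ∈ Der S | θ(α_L) ∈ S α_L for all L ∈ 𝒜}`; the condition is imposed for every linear form
`α` with kernel `L`, these being the non-zero scalar multiples of a single `α_L`. -/
def logDer (A : HyperplaneArrangement K V) :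
    Submodule (CoordRing K V) (Derivation K (CoordRing K V) (CoordRing K V)) where
  carrier := {θ | ∀ L ∈ A.hyperplanes, ∀ α : Dual K V, LinearMap.ker α = L →
    θ (SymmetricAlgebra.ι K (Dual K V) α) ∈ Ideal.span {SymmetricAlgebra.ι K (Dual K V) α}}
  add_mem' h₁ h₂ L hL α hα := by
    rw [Derivation.add_apply]
    exact Ideal.add_mem _ (h₁ L hL α hα) (h₂ L hL α hα)
  zero_mem' L hL α hα := by
    rw [Derivation.zero_apply]
    exact Ideal.zero_mem _
  smul_mem' f θ h L hL α hα := by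
    rw [Derivation.smul_apply]
    exact Ideal.mul_mem_left _ f (h L hL α hα)

/-- The derivation `θ` is homogeneous of (polynomial) degree `d`: it maps linear forms to
homogeneous polynomials of degree `d`. Here the `d`-th power of the space of linear forms in `S` is
the degree `d` part of `S`. The Euler derivation has degree `1`. -/
def IsHomogeneousDer (θ : Derivation K (CoordRing K V) (CoordRing K V)) (d : ℕ) : Prop :=
  ∀ α : Dual K V, θ (SymmetricAlgebra.ι K (Dual K V) α) ∈
    (LinearMap.range (SymmetricAlgebra.ι K (Dual K V))) ^ d

/-- `𝒜` is free with exponents `(d_i)`: `D(𝒜) ≃ ⨁ S[-d_i]` as graded modules, that is, `D(𝒜)` has an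
`S`-basis of homogeneous derivations of degrees `d_i`, where `i` runs over `dim V` indices. -/
def IsFreeWithExponents (A : HyperplaneArrangement K V) (d : Fin (finrank K V) → ℕ) : Prop :=
  ∃ b : Basis (Fin (finrank K V)) (CoordRing K V) A.logDer,
    ∀ i, IsHomogeneousDer (b i : Derivation K (CoordRing K V) (CoordRing K V)) (d i)

/-- `𝒜` is free. -/
def IsFree (A : HyperplaneArrangement K V) : Prop :=
  ∃ d : Fin (finrank K V) → ℕ, A.IsFreeWithExponents d

/-- `g(𝒜)`: the minimal number of generators of the `S`-module `D(𝒜)`. -/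
def minGen (A : HyperplaneArrangement K V) : ℕ :=
  A.logDer.spanFinrank

/-- `D(𝒜)` is finitely generated, so that `minGen` is the least cardinality of a generating set. -/
lemma logDer_fg [FiniteDimensional K V] (A : HyperplaneArrangement K V) : A.logDer.FG := by
  let b := finBasis K (Dual K V)
  have : IsNoetherianRing (CoordRing K V) :=
    isNoetherianRing_of_ringEquiv _ (SymmetricAlgebra.equivMvPolynomial b).symm.toRingEquiv
  let e : Derivation K (CoordRing K V) (CoordRing K V) →ₗ[CoordRing K V]
      (Fin (finrank K (Dual K V)) → CoordRing K V) :=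
    { toFun := fun θ i => θ (SymmetricAlgebra.ι K (Dual K V) (b i))
      map_add' := fun _ _ => rfl
      map_smul' := fun _ _ => rfl }
  have he : Function.Injective e := by
    intro θ₁ θ₂ h
    have hι : ∀ x, θ₁ (SymmetricAlgebra.ι K (Dual K V) x) =
        θ₂ (SymmetricAlgebra.ι K (Dual K V) x) := by
      have : (θ₁ : CoordRing K V →ₗ[K] CoordRing K V) ∘ₗ SymmetricAlgebra.ι K (Dual K V) =
          (θ₂ : CoordRing K V →ₗ[K] CoordRing K V) ∘ₗ SymmetricAlgebra.ι K (Dual K V) :=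
        b.ext fun i => congrFun h i
      exact fun x => LinearMap.congr_fun this x
    ext a
    induction a using SymmetricAlgebra.induction with
    | algebraMap r => simp
    | ι x => exact hι x
    | mul x y hx hy => rw [Derivation.leibniz, Derivation.leibniz, hx, hy]
    | add x y hx hy => rw [map_add, map_add, hx, hy]
  have := isNoetherian_of_injective e he
  exact IsNoetherian.noetherian _

end HyperplaneArrangement

end

/-!
Let `α` be a form defining `H`, let `R` be the coordinate ring of `H`, let `θ₁, …, θ_ℓ` be a
homogeneous basis of `D(𝒜')`, and let `fᵢ ∈ R` be the restriction of `θᵢ(α)` to `H`. A combination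
`∑ aᵢ θᵢ` lies in `D(𝒜)` exactly if the restrictions of the `aᵢ` form a relation between the `fᵢ`.
Everything is controlled by the graded `R`-module `Z ⊆ R^ℓ` of these relations, of rank `ℓ - 1`.

*Counting generators.* Let `𝔪` be the irrelevant ideal of `R`. Restricting the coefficients `aᵢ` and
their derivatives transversal to `H` maps `D(𝒜)` onto `Z / 𝔪 Z ⊕ R^ℓ / (𝔪 R^ℓ + Z)`, and the images
of generators of `D(𝒜)` span this `K`-vector space. The two dimensions are the numbers of minimal
generators of `Z` and of the ideal `I = (f₁, …, f_ℓ)`, so their sum is at most `ℓ + 2`. If `I` needs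
at least three generators, then `Z` is generated by `ℓ - 1` homogeneous elements by the graded
Nakayama lemma. Otherwise `I` is generated by two of the `fᵢ`, and `Z` by the `ℓ - 2` expressions of
the other `fᵢ` in these two, and the one relation between the two. This is
`exists_homogeneous_generators_syzygies`.

*Determinants.* Generators `w₁, …, w_{ℓ-1}` of `Z` give derivations `∑ᵢ wₖᵢ θᵢ` that kill `α` on `H`
and hence induce elements of `D(𝒜^H)`. By Saito's criterion (`exists_basis_of_det_dvd_defPoly`) they
form a basis if their determinant `N` divides the defining polynomial `Q(𝒜^H)`. If `M` is the
determinant of the `θᵢ`, which divides `Q(𝒜')` (`det_basis_dvd_defPoly`), then on `H` one has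
`mⱼ M = fⱼ N` for the maximal minors `mⱼ` of the matrix `w`, and these have no common prime factor
(`exists_minor_mul_det_eq`). Finally, `Q(𝒜')` restricts to the product of `Q(𝒜^H)` and a common
factor of all `fⱼ` (`exists_factor_restrict_defPoly` is a local form of this), because
`α θ(β) - β θ(α)` is divisible by all forms of `𝒜'` in the pencil spanned by `α` and a form `β`.
-/

noncomputable section

namespace MvPolynomial

/-! ### Graded submodules of free modules over polynomial rings -/

section Shifted

variable {τ ι K : Type*} [Field K]

/-- The component of degree `e` of a vector of polynomials, where the `i`-th standard basis vector
has degree `d i`. -/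
def shiftedComponent (d : ι → ℕ) (e : ℕ) :
    (ι → MvPolynomial τ K) →ₗ[K] (ι → MvPolynomial τ K) where
  toFun v i := if d i ≤ e then homogeneousComponent (e - d i) (v i) else 0
  map_add' v w := by
    ext1 i
    by_cases h : d i ≤ e <;> simp [h]
  map_smul' c v := by
    ext1 i
    by_cases h : d i ≤ e <;> simp [h]

lemma shiftedComponent_apply (d : ι → ℕ) (e : ℕ) (v : ι → MvPolynomial τ K) (i : ι) :
    shiftedComponent d e v i = if d i ≤ e then homogeneousComponent (e - d i) (v i) else 0 := rfl

lemma homogeneousComponent_mul_of_isHomogeneous {r : MvPolynomial τ K} {a : ℕ}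
    (hr : r.IsHomogeneous a) (e : ℕ) (p : MvPolynomial τ K) :
    homogeneousComponent e (r * p) = if a ≤ e then r * homogeneousComponent (e - a) p else 0 := by
  let := gradedAlgebra (σ := τ) (R := K)
  have h := DirectSum.coe_decompose_mul_of_left_mem (homogeneousSubmodule τ K) e
    (a := r) (b := p) hr
  simp only [← decomposition.decompose'_apply]
  exact h

lemma shiftedComponent_smul_of_isHomogeneous (d : ι → ℕ) {r : MvPolynomial τ K} {a : ℕ}
    (hr : r.IsHomogeneous a) (e : ℕ) (v : ι → MvPolynomial τ K) :
    shiftedComponent d e (r • v) = if a ≤ e then r • shiftedComponent d (e - a) v else 0 := by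
  ext1 i
  rw [shiftedComponent_apply, Pi.smul_apply, smul_eq_mul,
    homogeneousComponent_mul_of_isHomogeneous hr]
  by_cases h1 : a ≤ e
  · rw [if_pos h1, Pi.smul_apply, smul_eq_mul, shiftedComponent_apply]
    by_cases h2 : d i ≤ e - a
    · rw [if_pos (by omega), if_pos (by omega), if_pos h2, show e - d i - a = e - a - d i by omega]
    · rw [if_neg h2, mul_zero]
      by_cases h3 : d i ≤ e
      · rw [if_pos h3, if_neg (by omega)]
      · rw [if_neg h3]
  · rw [if_neg h1, Pi.zero_apply]
    by_cases h3 : d i ≤ e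
    · rw [if_pos h3, if_neg (by omega)]
    · rw [if_neg h3]

lemma shiftedComponent_shiftedComponent (d : ι → ℕ) (e e' : ℕ) (v : ι → MvPolynomial τ K) :
    shiftedComponent d e (shiftedComponent d e' v) =
      if e = e' then shiftedComponent d e' v else 0 := by
  ext1 i
  simp only [shiftedComponent_apply]
  by_cases h : e = e'
  · subst h
    by_cases h1 : d i ≤ e
    · simp [h1, shiftedComponent_apply, homogeneousComponent_of_mem (homogeneousComponent_mem _ _)]
    · simp [h1, shiftedComponent_apply]
  · rw [if_neg h]
    by_cases h1 : d i ≤ e'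
    · by_cases h2 : d i ≤ e
      · rw [if_pos h2, if_pos h1, homogeneousComponent_of_mem (homogeneousComponent_mem _ _),
          if_neg (by omega), Pi.zero_apply]
      · rw [if_neg h2, Pi.zero_apply]
    · simp [h1]

lemma exists_sum_shiftedComponent [Finite ι] (d : ι → ℕ) (v : ι → MvPolynomial τ K) :
    ∃ n, ∑ e ∈ Finset.range n, shiftedComponent d e v = v := by
  have := Fintype.ofFinite ι
  refine ⟨∑ i, (d i + (v i).totalDegree + 1), ?_⟩
  ext1 i
  set n := ∑ i, (d i + (v i).totalDegree + 1) with hn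
  have hi : d i + (v i).totalDegree + 1 ≤ n :=
    Finset.single_le_sum (f := fun i => d i + (v i).totalDegree + 1) (fun _ _ => Nat.zero_le _)
      (Finset.mem_univ i)
  rw [Finset.sum_apply]
  simp only [shiftedComponent_apply]
  obtain ⟨m, hm⟩ := Nat.exists_eq_add_of_le hi
  rw [hm, add_assoc, add_assoc, Finset.sum_range_add, Finset.sum_eq_zero, zero_add]
  · simp only [Nat.le_add_right, if_true, Nat.add_sub_cancel_left]
    rw [← add_assoc, Finset.sum_range_add, sum_homogeneousComponent, Finset.sum_eq_zero, add_zero]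
    intro x _
    exact homogeneousComponent_eq_zero _ _ (by omega)
  · intro e he
    rw [if_neg (by simpa using he)]

/-- A submodule is graded (for the degree shifts `d`) if it contains all components of its
elements. -/
def IsShiftGraded (d : ι → ℕ) (N : Submodule (MvPolynomial τ K) (ι → MvPolynomial τ K)) : Prop :=
  ∀ v ∈ N, ∀ e, shiftedComponent d e v ∈ N

lemma shiftedComponent_smul (d : ι → ℕ) (r : MvPolynomial τ K) (e : ℕ)
    (v : ι → MvPolynomial τ K) :
    shiftedComponent d e (r • v) = ∑ a ∈ Finset.range (r.totalDegree + 1),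
      if a ≤ e then homogeneousComponent a r • shiftedComponent d (e - a) v else 0 := by
  conv_lhs => rw [← sum_homogeneousComponent r, Finset.sum_smul, map_sum]
  exact Finset.sum_congr rfl fun a _ =>
    shiftedComponent_smul_of_isHomogeneous d (homogeneousComponent_isHomogeneous a r) e v

lemma isShiftGraded_span (d : ι → ℕ) (T : Set (ι → MvPolynomial τ K))
    (hT : ∀ t ∈ T, ∃ e, shiftedComponent d e t = t) :
    IsShiftGraded d (Submodule.span (MvPolynomial τ K) T) := by
  intro v hv
  induction hv using Submodule.span_induction with
  | mem t ht =>
    intro e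
    obtain ⟨e', he'⟩ := hT t ht
    rw [← he', shiftedComponent_shiftedComponent]
    split_ifs
    · rw [he']
      exact Submodule.subset_span ht
    · exact Submodule.zero_mem _
  | zero => intro e; simp
  | add x y _ _ hx hy => intro e; rw [map_add]; exact Submodule.add_mem _ (hx e) (hy e)
  | smul r x _ hx =>
    intro e
    rw [shiftedComponent_smul]
    refine Submodule.sum_mem _ fun a _ => ?_
    split_ifs
    · exact Submodule.smul_mem _ _ (hx _)
    · exact Submodule.zero_mem _

lemma IsShiftGraded.sup {d : ι → ℕ} {N N' : Submodule (MvPolynomial τ K) (ι → MvPolynomial τ K)}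
    (hN : IsShiftGraded d N) (hN' : IsShiftGraded d N') : IsShiftGraded d (N ⊔ N') := by
  intro v hv e
  obtain ⟨x, hx, y, hy, rfl⟩ := Submodule.mem_sup.1 hv
  rw [map_add]
  exact Submodule.add_mem_sup (hN x hx e) (hN' y hy e)

/-- The ideal of polynomials without constant term. -/
abbrev irrelevantIdeal (τ K : Type*) [Field K] : Ideal (MvPolynomial τ K) :=
  RingHom.ker (constantCoeff (R := K) (σ := τ))

/-- Graded Nakayama lemma. The larger submodule `N` need not be graded. -/
lemma IsShiftGraded.le_of_le_sup_smul [Finite ι] {d : ι → ℕ}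
    {N N' : Submodule (MvPolynomial τ K) (ι → MvPolynomial τ K)} (hN' : IsShiftGraded d N')
    (h : N ≤ N' ⊔ irrelevantIdeal τ K • N) : N ≤ N' := by
  have key : ∀ e, ∀ v ∈ N, shiftedComponent d e v ∈ N' := by
    intro e
    induction e using Nat.strong_induction_on with
    | _ e ih =>
      intro v hv
      obtain ⟨x, hx, y, hy, rfl⟩ := Submodule.mem_sup.1 (h hv)
      rw [map_add]
      refine N'.add_mem (hN' x hx e) ?_
      clear hv
      induction hy using Submodule.smul_induction_on' with
      | smul r hr w hw =>
        rw [shiftedComponent_smul]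
        refine Submodule.sum_mem _ fun a _ => ?_
        split_ifs with hae
        · rcases Nat.eq_zero_or_pos a with rfl | ha
          · rw [homogeneousComponent_zero, show coeff 0 r = 0 from hr, map_zero, zero_smul]
            exact N'.zero_mem
          · exact N'.smul_mem _ (ih _ (by omega) w hw)
        · exact N'.zero_mem
      | add y _ z _ hy hz =>
        rw [map_add]
        exact N'.add_mem hy hz
  intro v hv
  obtain ⟨n, hn⟩ := exists_sum_shiftedComponent d v
  rw [← hn]
  exact Submodule.sum_mem _ fun e _ => key e v hv

/-- The `K`-vector space `N / 𝔪 N`, realised inside the quotient of the ambient module by `𝔪 N`,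
where `𝔪` is the irrelevant ideal. -/
def fiber (N : Submodule (MvPolynomial τ K) (ι → MvPolynomial τ K)) :
    Submodule K ((ι → MvPolynomial τ K) ⧸ (irrelevantIdeal τ K • N)) :=
  (N.restrictScalars K).map ((irrelevantIdeal τ K • N).mkQ.restrictScalars K)

lemma mkQ_smul_eq {N : Submodule (MvPolynomial τ K) (ι → MvPolynomial τ K)}
    {P : Submodule (MvPolynomial τ K) (ι → MvPolynomial τ K)}
    (hP : irrelevantIdeal τ K • N ≤ P) (r : MvPolynomial τ K) {v : ι → MvPolynomial τ K}
    (hv : v ∈ N) : P.mkQ (r • v) = constantCoeff r • P.mkQ v := by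
  have h2 : constantCoeff r • P.mkQ v = P.mkQ ((C (constantCoeff r) : MvPolynomial τ K) • v) := by
    have : (C (constantCoeff r) : MvPolynomial τ K) • v = constantCoeff r • v := by
      ext1 i; simp [C_mul']
    rw [this]; rfl
  rw [h2, ← sub_eq_zero, ← map_sub, ← sub_smul, Submodule.mkQ_apply,
    Submodule.Quotient.mk_eq_zero]
  refine hP (Submodule.smul_mem_smul ?_ hv)
  simp [RingHom.mem_ker]

lemma fiber_le_span {γ : Type*} {N : Submodule (MvPolynomial τ K) (ι → MvPolynomial τ K)}
    {z : γ → ι → MvPolynomial τ K} (hz : Submodule.span (MvPolynomial τ K) (Set.range z) = N) :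
    fiber N ≤ Submodule.span K (Set.range fun k => (irrelevantIdeal τ K • N).mkQ (z k)) := by
  rintro _ ⟨v, hv, rfl⟩
  change (irrelevantIdeal τ K • N).mkQ v ∈ _
  replace hv : v ∈ Submodule.span (MvPolynomial τ K) (Set.range z) := hz ▸ hv
  induction hv using Submodule.span_induction with
  | mem t ht =>
    obtain ⟨k, rfl⟩ := ht
    exact Submodule.subset_span ⟨k, rfl⟩
  | zero => simp
  | add x y _ _ hx hy => rw [map_add]; exact Submodule.add_mem _ hx hy
  | smul r x hx' hx =>
    rw [mkQ_smul_eq le_rfl r (hz ▸ hx')]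
    exact Submodule.smul_mem _ _ hx

/-- A graded submodule whose fiber has dimension at most `k` has `k` homogeneous generators. -/
lemma IsShiftGraded.exists_homogeneous_generators [Finite ι] {d : ι → ℕ}
    {N : Submodule (MvPolynomial τ K) (ι → MvPolynomial τ K)} (hN : IsShiftGraded d N)
    [FiniteDimensional K (fiber N)] {k : ℕ} (hk : finrank K (fiber N) ≤ k) :
    ∃ (w : Fin k → ι → MvPolynomial τ K) (e : Fin k → ℕ),
      (∀ j, shiftedComponent d (e j) (w j) = w j) ∧
      Submodule.span (MvPolynomial τ K) (Set.range w) = N := by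
  set π := (irrelevantIdeal τ K • N).mkQ.restrictScalars K with hπ
  set T : Set (ι → MvPolynomial τ K) := {t | t ∈ N ∧ ∃ e, shiftedComponent d e t = t} with hT
  have hspan : Submodule.span K (π '' T) = fiber N := by
    rw [Submodule.span_image]
    unfold fiber
    congr 1
    refine le_antisymm (Submodule.span_le.2 fun t ht => ht.1) fun v hv => ?_
    obtain ⟨n, hn⟩ := exists_sum_shiftedComponent d v
    rw [← hn]
    exact Submodule.sum_mem _ fun e _ => Submodule.subset_span
      ⟨hN v hv e, e, by rw [shiftedComponent_shiftedComponent, if_pos rfl]⟩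
  have hfd : FiniteDimensional K (Submodule.span K (π '' T)) := by rw [hspan]; infer_instance
  obtain ⟨r, hr, f, hf, hfs⟩ : ∃ r ≤ k, ∃ f : Fin r → _, (∀ i, f i ∈ π '' T) ∧
      Submodule.span K (Set.range f) = Submodule.span K (π '' T) := by
    obtain ⟨f, hf, hfs, -⟩ := Submodule.exists_fun_fin_finrank_span_eq K (π '' T)
    exact ⟨_, by rw [hspan]; exact hk, f, hf, hfs⟩
  choose g hgT hgf using hf
  -- At most `k` homogeneous elements span the fiber; the list is padded with zeros.
  let w : Fin k → ι → MvPolynomial τ K := fun j => if h : (j : ℕ) < r then g ⟨j, h⟩ else 0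
  have hw : ∀ j, w j ∈ T := by
    intro j
    by_cases h : (j : ℕ) < r
    · simp only [w, dif_pos h]; exact hgT _
    · simp only [w, dif_neg h]; exact ⟨N.zero_mem, 0, map_zero _⟩
  choose hwN e he using hw
  refine ⟨w, e, he, le_antisymm (Submodule.span_le.2 ?_) ?_⟩
  · rintro _ ⟨j, rfl⟩
    exact hwN j
  · refine IsShiftGraded.le_of_le_sup_smul (isShiftGraded_span d _ ?_) ?_
    · rintro _ ⟨j, rfl⟩
      exact ⟨e j, he j⟩
    · intro v hv
      have h1 : π v ∈ Submodule.span K (Set.range f) := by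
        rw [hfs, hspan]
        exact ⟨v, hv, rfl⟩
      have h2 : Set.range f = π '' Set.range g := by
        ext x
        constructor
        · rintro ⟨i, rfl⟩
          exact ⟨g i, ⟨i, rfl⟩, hgf i⟩
        · rintro ⟨_, ⟨i, rfl⟩, rfl⟩
          exact ⟨i, (hgf i).symm⟩
      rw [h2, Submodule.span_image] at h1
      obtain ⟨u, hu, huv⟩ := h1
      have hu' : u ∈ Submodule.span (MvPolynomial τ K) (Set.range w) := by
        refine Submodule.span_le_restrictScalars K (MvPolynomial τ K) _
          (Submodule.span_mono ?_ hu)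
        rintro _ ⟨i, rfl⟩
        refine ⟨⟨i, i.2.trans_le hr⟩, ?_⟩
        simp [w]
      have h3 : v - u ∈ irrelevantIdeal τ K • N := by
        rw [← Submodule.Quotient.mk_eq_zero, ← Submodule.mkQ_apply, map_sub, sub_eq_zero]
        exact huv.symm
      rw [← add_sub_cancel u v]
      exact Submodule.add_mem_sup hu' h3

end Shifted

end MvPolynomial

/-! ### Divisibility and relations in factorial rings -/

section Factorial

variable {R : Type*} [CommRing R] [IsDomain R] [UniqueFactorizationMonoid R]

/-- In a factorial domain the relations between two elements, not both zero, are the multiples of a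
single one. -/
lemma exists_generating_relation_pair (p q : R) (h : ¬ (p = 0 ∧ q = 0)) :
    ∃ s t : R, s * p + t * q = 0 ∧
      ∀ a b, a * p + b * q = 0 → ∃ c, a = c * s ∧ b = c * t := by
  let _ : GCDMonoid R := UniqueFactorizationMonoid.toGCDMonoid R
  obtain ⟨p', q', hp, hq, hu⟩ := extract_gcd p q
  have hg : gcd p q ≠ 0 := by rwa [Ne, gcd_eq_zero_iff]
  set g := gcd p q
  refine ⟨q', -p', by rw [hp, hq]; ring, fun a b hab => ?_⟩
  have h1 : a * p' = -b * q' := by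
    refine mul_left_cancel₀ hg ?_
    rw [hp, hq] at hab
    linear_combination hab
  have hrel : IsRelPrime q' p' := (gcd_isUnit_iff_isRelPrime.1 hu).symm
  by_cases hq0 : q' = 0
  · subst hq0
    obtain ⟨u, rfl⟩ : IsUnit p' := isRelPrime_zero_left.1 hrel
    refine ⟨-b * ↑u⁻¹, ?_, by simp⟩
    rw [mul_zero] at h1 ⊢
    simpa using h1
  · obtain ⟨c, rfl⟩ : q' ∣ a := hrel.dvd_of_dvd_mul_right ⟨-b, by rw [h1]; ring⟩
    refine ⟨c, mul_comm _ _, mul_left_cancel₀ hq0 ?_⟩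
    linear_combination h1

/-- Divisibility in a factorial domain can be checked one prime at a time. -/
lemma dvd_of_forall_prime {d q : R} (hd₀ : d ≠ 0) (hq : q ≠ 0)
    (h : ∀ p, Prime p → ∃ c, ¬ p ∣ c ∧ d ∣ c * q) : d ∣ q := by
  let _ : GCDMonoid R := UniqueFactorizationMonoid.toGCDMonoid R
  obtain ⟨d', q', hd, hq', hu⟩ := extract_gcd d q
  have hg : gcd d q ≠ 0 := fun h0 => hq (by rw [hq', h0, zero_mul])
  set g := gcd d q
  suffices IsUnit d' by
    rw [hd, hq']
    exact mul_dvd_mul_left _ this.dvd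
  by_contra hd'
  have hd0 : d' ≠ 0 := by
    rintro rfl
    exact hd₀ (by rw [hd, mul_zero])
  obtain ⟨p, hp, hpd⟩ := WfDvdMonoid.exists_irreducible_factor hd' hd0
  rw [UniqueFactorizationMonoid.irreducible_iff_prime] at hp
  obtain ⟨c, hpc, hdc⟩ := h p hp
  rw [hd, hq', mul_left_comm] at hdc
  have h2 := hpd.trans ((mul_dvd_mul_iff_left hg).1 hdc)
  exact hp.not_isUnit (isUnit_of_dvd_unit (dvd_gcd hpd ((hp.dvd_or_dvd h2).resolve_left hpc)) hu)

end Factorial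

/-- A non-zero finite family can be divided by a common factor so that no prime
divides all members. -/
lemma exists_common_factor {R ι : Type*} [CommRing R] [UniqueFactorizationMonoid R] [Finite ι]
    (f : ι → R) (hf : f ≠ 0) :
    ∃ (g : R) (f' : ι → R), (∀ i, f i = g * f' i) ∧
      ∀ p, Prime p → ∃ i, ¬ p ∣ f' i := by
  have := Fintype.ofFinite ι
  let _ : NormalizationMonoid R := (UniqueFactorizationMonoid.strongNormalizationMonoid).toNormalizationMonoid
  let _ : NormalizedGCDMonoid R := UniqueFactorizationMonoid.toNormalizedGCDMonoid R
  obtain ⟨i, hi⟩ := Function.ne_iff.1 hf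
  obtain ⟨f', h, h1⟩ := Finset.extract_gcd (s := Finset.univ) f ⟨i, Finset.mem_univ i⟩
  refine ⟨_, f', fun i => h i (Finset.mem_univ i), fun p hp => ?_⟩
  by_contra! hc
  exact hp.not_isUnit (isUnit_of_dvd_one (h1 ▸ Finset.dvd_gcd fun j _ => hc j))

/-! ### Relations between homogeneous polynomials -/

section Syzygies

/-- The relations `∑ aᵢ fᵢ = 0` between the members of a finite family in a ring. -/
abbrev syzygies {R ι : Type*} [CommRing R] [Fintype ι] (f : ι → R) : Submodule R (ι → R) :=
  LinearMap.ker (Fintype.linearCombination R f)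

lemma mem_syzygies {R ι : Type*} [CommRing R] [Fintype ι] {f a : ι → R} :
    a ∈ syzygies f ↔ ∑ i, a i * f i = 0 := by
  simp [Fintype.linearCombination_apply]

open MvPolynomial

variable {τ ι K : Type*} [Field K]

lemma shiftedComponent_single [DecidableEq ι] (d : ι → ℕ) (i : ι) :
    shiftedComponent d (d i) (Pi.single i (1 : MvPolynomial τ K)) = Pi.single i 1 := by
  ext1 j
  rw [shiftedComponent_apply]
  rcases eq_or_ne j i with rfl | h
  · simp [homogeneousComponent_eq_self (isHomogeneous_one τ K)]
  · simp [Pi.single_eq_of_ne h]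

variable [Fintype ι]

lemma isShiftGraded_syzygies {d : ι → ℕ} {f : ι → MvPolynomial τ K}
    (hf : ∀ i, (f i).IsHomogeneous (d i)) : IsShiftGraded d (syzygies f) := by
  intro v hv e
  rw [mem_syzygies] at hv ⊢
  have h := congrArg (homogeneousComponent e) hv
  rw [map_sum, map_zero] at h
  rw [← h]
  refine Finset.sum_congr rfl fun i _ => ?_
  rw [mul_comm (v i), homogeneousComponent_mul_of_isHomogeneous (hf i), shiftedComponent_apply]
  split_ifs
  · rw [mul_comm]
  · rw [zero_mul]

/-- If the module of relations between homogeneous polynomials `fᵢ`, together with two standard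
basis vectors, spans everything, then it is generated by one element less than there are `fᵢ`:
there is one generator expressing each of the remaining `fᵢ` by the two selected ones, and one
relation between these two. -/
lemma exists_generators_of_sup_pair [DecidableEq ι] {f : ι → MvPolynomial τ K} (hf0 : f ≠ 0)
    {j k : ι} (hjk : j ≠ k)
    (h : syzygies f ⊔ Submodule.span _ {Pi.single j 1, Pi.single k 1} = ⊤) :
    ∃ z : {i // i ≠ k} → ι → MvPolynomial τ K,
      Submodule.span (MvPolynomial τ K) (Set.range z) = syzygies f := by
  set E := Submodule.span (MvPolynomial τ K)
    ({Pi.single j 1, Pi.single k 1} : Set (ι → MvPolynomial τ K)) with hE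
  have hfjk : ¬ (f j = 0 ∧ f k = 0) := by
    rintro ⟨h1, h2⟩
    have h3 : E ≤ syzygies f := by
      rw [hE, Submodule.span_le]
      rintro v (rfl | rfl)
      · change _ ∈ syzygies f
        rw [mem_syzygies]; simp [Pi.single_apply, h1]
      · change _ ∈ syzygies f
        rw [mem_syzygies]; simp [Pi.single_apply, h2]
    rw [sup_eq_left.2 h3] at h
    refine hf0 (funext fun i => ?_)
    have h4 : Pi.single i 1 ∈ syzygies f := h ▸ Submodule.mem_top
    rw [mem_syzygies] at h4
    simpa [Pi.single_apply] using h4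
  obtain ⟨s, t, hst, hgen⟩ := exists_generating_relation_pair (f j) (f k) hfjk
  have hex : ∀ i, ∃ z ∈ syzygies f, ∃ y ∈ E, z + y = Pi.single i 1 := fun i =>
    Submodule.mem_sup.1 (h ▸ Submodule.mem_top)
  choose z hz y hy hzy using hex
  have hpair : ∀ a b, (∑ i, (a • Pi.single j 1 + b • Pi.single k 1 : ι → MvPolynomial τ K) i * f i)
      = a * f j + b * f k := by
    intro a b
    simp [Pi.single_apply, add_mul, Finset.sum_add_distrib]
  let Z : {i // i ≠ k} → ι → MvPolynomial τ K := fun i =>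
    if (i : ι) = j then s • Pi.single j 1 + t • Pi.single k 1 else z i
  have hZ : Submodule.span (MvPolynomial τ K) (Set.range Z) ≤ syzygies f := by
    rw [Submodule.span_le]
    rintro _ ⟨i, rfl⟩
    by_cases hi : (i : ι) = j
    · simp only [Z, if_pos hi]
      change _ ∈ syzygies f
      rw [mem_syzygies, hpair, hst]
    · simp only [Z, if_neg hi]
      exact hz i
  refine ⟨Z, le_antisymm hZ fun v hv => ?_⟩
  have htop : Submodule.span (MvPolynomial τ K) (Set.range Z) ⊔ E = ⊤ := by
    rw [eq_top_iff, ← (Pi.basisFun (MvPolynomial τ K) ι).span_eq, Submodule.span_le]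
    rintro _ ⟨i, rfl⟩
    rw [Pi.basisFun_apply]
    by_cases hij : i = j
    · exact Submodule.mem_sup_right (Submodule.subset_span (by simp [hij]))
    by_cases hik : i = k
    · exact Submodule.mem_sup_right (Submodule.subset_span (by simp [hik]))
    rw [SetLike.mem_coe, ← hzy i]
    refine Submodule.add_mem_sup (Submodule.subset_span ⟨⟨i, hik⟩, ?_⟩) (hy i)
    simp only [Z, if_neg hij]
  obtain ⟨u, hu, y', hy', rfl⟩ := Submodule.mem_sup.1
    (htop ▸ Submodule.mem_top : v ∈ Submodule.span (MvPolynomial τ K) (Set.range Z) ⊔ E)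
  refine Submodule.add_mem _ hu ?_
  have hy'' : y' ∈ syzygies f := by simpa using Submodule.sub_mem _ hv (hZ hu)
  obtain ⟨a, b, rfl⟩ := Submodule.mem_span_pair.1 hy'
  rw [mem_syzygies, hpair] at hy''
  obtain ⟨c, rfl, rfl⟩ := hgen a b hy''
  have : (c * s) • Pi.single j 1 + (c * t) • Pi.single k 1 = c • Z ⟨j, hjk⟩ := by
    simp only [Z, if_true, smul_add, smul_smul]
  rw [this]
  exact Submodule.smul_mem _ _ (Submodule.subset_span ⟨_, rfl⟩)

/-- Let `S → R[ε]`, `s ↦ ρ s + ε δ s`, be a surjective ring homomorphism to the dual numbers over a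
polynomial ring `R`. If the `S`-module of all `a` with `∑ ρ aᵢ fᵢ = 0` has at most
`k + 3` generators, where the `fᵢ` are `k + 1` homogeneous polynomials, then the module of relations
between the `fᵢ` is generated by `k` homogeneous elements.

The fibers at the origin of the module of relations and of the ideal generated by the `fᵢ` have
dimensions with sum at most `k + 3`. Hence either the first one is at most `k`, or the second one
is at most two, and then two of the `fᵢ` generate the ideal. -/
theorem exists_homogeneous_generators_syzygies {S : Type*} [CommRing S]
    (ρ : S →+* MvPolynomial τ K) (hρ : Function.Surjective ρ) (δ : S →+ MvPolynomial τ K)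
    (hδ : ∀ s t, δ (s * t) = ρ s * δ t + ρ t * δ s) {x : S} (hx : ρ x = 0) (hx' : δ x = 1)
    {d : ι → ℕ} {f : ι → MvPolynomial τ K} (hf : ∀ i, (f i).IsHomogeneous (d i)) (hf0 : f ≠ 0)
    {k : ℕ} (hk : Fintype.card ι = k + 1) (hk1 : 1 ≤ k) {n : ℕ} (hn : n ≤ k + 3)
    (η : Fin n → ι → S)
    (hη : ∀ a, a ∈ Submodule.span S (Set.range η) ↔ ∑ i, ρ (a i) * f i = 0) :
    ∃ (w : Fin k → ι → MvPolynomial τ K) (e : Fin k → ℕ),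
      (∀ j, shiftedComponent d (e j) (w j) = w j) ∧
      Submodule.span (MvPolynomial τ K) (Set.range w) = syzygies f := by
  classical
  set Z := syzygies f with hZdef
  have hZ : IsShiftGraded d Z := isShiftGraded_syzygies hf
  set P := Z ⊔ irrelevantIdeal τ K • (⊤ : Submodule (MvPolynomial τ K) (ι → MvPolynomial τ K))
  set π₁ := (irrelevantIdeal τ K • Z).mkQ with hπ₁
  set π₂ := P.mkQ with hπ₂
  let Φ : (ι → S) → ((ι → MvPolynomial τ K) ⧸ (irrelevantIdeal τ K • Z)) ×
      ((ι → MvPolynomial τ K) ⧸ P) := fun a => (π₁ fun i => ρ (a i), π₂ fun i => δ (a i))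
  -- `Φ` is semilinear over the evaluation of `S` at the origin, so generators of its domain give
  -- vectors spanning its image.
  have hmem : ∀ a, a ∈ Submodule.span S (Set.range η) →
      Φ a ∈ Submodule.span K (Set.range fun j => Φ (η j)) := by
    intro a ha
    induction ha using Submodule.span_induction with
    | mem a ha =>
      obtain ⟨j, rfl⟩ := ha
      exact Submodule.subset_span ⟨j, rfl⟩
    | zero =>
      have : Φ 0 = 0 := by
        ext1
        · change π₁ (fun i => ρ 0) = 0
          simp only [map_zero]
          exact map_zero π₁
        · change π₂ (fun i => δ 0) = 0
          simp only [map_zero]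
          exact map_zero π₂
      rw [this]
      exact Submodule.zero_mem _
    | add a b _ _ ha hb =>
      have : Φ (a + b) = Φ a + Φ b := by
        ext1
        · simp only [Φ, Pi.add_apply, map_add, Prod.fst_add]
          exact map_add π₁ _ _
        · simp only [Φ, Pi.add_apply, map_add, Prod.snd_add]
          exact map_add π₂ _ _
      rw [this]
      exact Submodule.add_mem _ ha hb
    | smul s a ha' ha =>
      have hav : (fun i => ρ (a i)) ∈ Z := mem_syzygies.2 ((hη a).1 ha')
      have : Φ (s • a) = constantCoeff (ρ s) • Φ a := by
        ext1
        · change π₁ (fun i => ρ (s * a i)) = constantCoeff (ρ s) • π₁ fun i => ρ (a i)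
          rw [← mkQ_smul_eq le_rfl (ρ s) hav]
          simp only [map_mul]
          rfl
        · change π₂ (fun i => δ (s * a i)) = constantCoeff (ρ s) • π₂ fun i => δ (a i)
          rw [← mkQ_smul_eq (N := ⊤) le_sup_right (ρ s) Submodule.mem_top, ← sub_eq_zero,
            ← map_sub, hπ₂, Submodule.mkQ_apply, Submodule.Quotient.mk_eq_zero]
          -- The Leibniz rule leaves the term `δ s • ρ a`, which is a relation and dies in the target.
          refine Submodule.mem_sup_left ?_
          convert Z.smul_mem (δ s) hav using 1
          ext1 i
          simp only [hδ, Pi.sub_apply, Pi.smul_apply, smul_eq_mul]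
          ring
      rw [this]
      exact Submodule.smul_mem _ _ ha
  -- Both components can be prescribed, the second one by adding multiples of `x`.
  have hle : (fiber Z).prod (⊤ : Submodule K ((ι → MvPolynomial τ K) ⧸ P)) ≤
      Submodule.span K (Set.range fun j => Φ (η j)) := by
    rintro ⟨q₁, q₂⟩ ⟨h₁, -⟩
    obtain ⟨z, hz, rfl⟩ := h₁
    obtain ⟨u, rfl⟩ := P.mkQ_surjective q₂
    choose s hs using fun i => hρ (z i)
    choose t ht using fun i => hρ (u i - δ (s i))
    have h1 : (fun i => ρ (s i + x * t i)) = z := by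
      ext1 i; rw [map_add, map_mul, hx, zero_mul, add_zero, hs]
    have h2 : (fun i => δ (s i + x * t i)) = u := by
      ext1 i; rw [map_add, hδ, hx, hx', ht]; ring
    have h3 := hmem (fun i => s i + x * t i) ((hη _).2 (by
      simp only [congrFun h1]
      exact mem_syzygies.1 hz))
    simp only [Φ, h1, h2] at h3
    exact h3
  have hfd : FiniteDimensional K (Submodule.span K (Set.range fun j => Φ (η j))) :=
    FiniteDimensional.span_of_finite K (Set.finite_range _)
  let ψ : (fiber Z × ((ι → MvPolynomial τ K) ⧸ P)) →ₗ[K]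
      Submodule.span K (Set.range fun j => Φ (η j)) :=
    LinearMap.codRestrict _ ((fiber Z).subtype.prodMap LinearMap.id)
      fun q => hle ⟨q.1.2, Submodule.mem_top⟩
  have hψ : Function.Injective ψ := by
    rw [LinearMap.injective_codRestrict_iff]
    exact (fiber Z).subtype_injective.prodMap Function.injective_id
  have hfdp := Module.Finite.of_injective ψ hψ
  have hfd1 : FiniteDimensional K (fiber Z) :=
    Module.Finite.of_surjective (LinearMap.fst K _ ((ι → MvPolynomial τ K) ⧸ P))
      LinearMap.fst_surjective
  have hfd2 : FiniteDimensional K ((ι → MvPolynomial τ K) ⧸ P) :=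
    Module.Finite.of_surjective (LinearMap.snd K (fiber Z) _) LinearMap.snd_surjective
  have hsum : finrank K (fiber Z) + finrank K ((ι → MvPolynomial τ K) ⧸ P) ≤ k + 3 := by
    rw [← Module.finrank_prod]
    refine (LinearMap.finrank_le_finrank_of_injective hψ).trans
      ((finrank_range_le_card _).trans ?_)
    simpa
  refine hZ.exists_homogeneous_generators ?_
  by_cases h3 : 3 ≤ finrank K ((ι → MvPolynomial τ K) ⧸ P)
  · omega
  -- From here on the ideal of the `fᵢ` has a fiber of dimension at most two, so that two of the
  -- `fᵢ` generate it.
  have hspan : Submodule.span K (Set.range fun i => π₂ (Pi.single i 1)) = ⊤ := by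
    rw [eq_top_iff]
    rintro q -
    obtain ⟨v, rfl⟩ := P.mkQ_surjective q
    have hv : v ∈ Submodule.span (MvPolynomial τ K) (Set.range (Pi.basisFun (MvPolynomial τ K) ι)) :=
      by rw [Basis.span_eq]; exact Submodule.mem_top
    induction hv using Submodule.span_induction with
    | mem v hv =>
      obtain ⟨i, rfl⟩ := hv
      exact Submodule.subset_span ⟨i, by simp [hπ₂]⟩
    | zero => simp
    | add v w _ _ hv hw => rw [map_add]; exact Submodule.add_mem _ hv hw
    | smul r v _ hv =>
      rw [mkQ_smul_eq (N := ⊤) le_sup_right r Submodule.mem_top]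
      exact Submodule.smul_mem _ _ hv
  obtain ⟨J, hJ, hJspan⟩ : ∃ J : Finset ι, J.card ≤ 2 ∧
      Submodule.span K ((fun i => π₂ (Pi.single i 1)) '' (J : Set ι)) = ⊤ := by
    have hfds : FiniteDimensional K (Submodule.span K (Set.range fun i => π₂ (Pi.single i 1))) := by
      rw [hspan]; infer_instance
    obtain ⟨r, hr, g, hg, hgs⟩ : ∃ r ≤ 2, ∃ g : Fin r → _,
        (∀ i, g i ∈ Set.range fun i => π₂ (Pi.single i 1)) ∧ Submodule.span K (Set.range g) =
          Submodule.span K (Set.range fun i => π₂ (Pi.single i 1)) := by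
      obtain ⟨g, hg, hgs, -⟩ := Submodule.exists_fun_fin_finrank_span_eq K
        (Set.range fun i => π₂ (Pi.single i 1))
      exact ⟨_, by rw [hspan, finrank_top]; omega, g, hg, hgs⟩
    choose c hc using hg
    refine ⟨Finset.univ.image c, Finset.card_image_le.trans ?_, ?_⟩
    · rwa [Finset.card_univ, Fintype.card_fin]
    · rw [← hspan, ← hgs, Finset.coe_image, Finset.coe_univ, Set.image_univ, ← Set.range_comp]
      congr 2
      exact funext hc
  obtain ⟨J', hJJ', hJ'⟩ := Finset.exists_superset_card_eq hJ (by omega)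
  obtain ⟨j, l, hjl, rfl⟩ := Finset.card_eq_two.1 hJ'
  obtain ⟨z, hz⟩ := exists_generators_of_sup_pair hf0 hjl (by
    have hgr : IsShiftGraded d (Z ⊔ Submodule.span _ {Pi.single j 1, Pi.single l 1}) := by
      refine hZ.sup (isShiftGraded_span d _ ?_)
      rintro v (rfl | rfl)
      · exact ⟨_, shiftedComponent_single d j⟩
      · exact ⟨_, shiftedComponent_single d l⟩
    refine top_le_iff.1 (hgr.le_of_le_sup_smul ?_)
    rintro v -
    have hv : π₂ v ∈ Submodule.span K ((fun i => π₂ (Pi.single i 1)) '' (J : Set ι)) := by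
      rw [hJspan]; exact Submodule.mem_top
    rw [← Set.image_image] at hv
    obtain ⟨u, hu, huv⟩ := (Submodule.span_image (π₂.restrictScalars K)).le hv
    have hu' : u ∈ Submodule.span (MvPolynomial τ K)
        ({Pi.single j 1, Pi.single l 1} : Set (ι → MvPolynomial τ K)) := by
      refine Submodule.span_le_restrictScalars K (MvPolynomial τ K) _ (Submodule.span_mono ?_ hu)
      rintro _ ⟨i, hi, rfl⟩
      have := hJJ' hi
      rw [Finset.mem_insert, Finset.mem_singleton] at this
      rcases this with rfl | rfl <;> simp
    have h4 : v - u ∈ P := by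
      rw [← Submodule.Quotient.mk_eq_zero, ← Submodule.mkQ_apply, map_sub, sub_eq_zero]
      exact huv.symm
    rw [← sub_add_cancel v u]
    refine Submodule.add_mem _ ?_ (Submodule.mem_sup_left (Submodule.mem_sup_right hu'))
    exact (sup_le (le_sup_of_le_left le_sup_left) le_sup_right : P ≤ _) h4)
  have hfdz : FiniteDimensional K
      (Submodule.span K (Set.range fun i => (irrelevantIdeal τ K • Z).mkQ (z i))) :=
    FiniteDimensional.span_of_finite K (Set.finite_range _)
  refine (Submodule.finrank_mono (fiber_le_span hz)).trans ((finrank_range_le_card _).trans ?_)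
  rw [Fintype.card_subtype_compl, Fintype.card_subtype_eq, hk]
  exact le_rfl

end Syzygies

namespace HyperplaneArrangement

/-! ### The coordinate ring and restriction to a subspace -/

section CoordRing

variable {K V : Type*} [Field K] [AddCommGroup V] [Module K V]

open SymmetricAlgebra

lemma derivation_ext {θ₁ θ₂ : Derivation K (CoordRing K V) (CoordRing K V)}
    (h : ∀ α : Dual K V, θ₁ (ι K _ α) = θ₂ (ι K _ α)) : θ₁ = θ₂ := by
  ext a
  induction a using SymmetricAlgebra.induction with
  | algebraMap r => simp
  | ι x => exact h x
  | mul x y hx hy => rw [Derivation.leibniz, Derivation.leibniz, hx, hy]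
  | add x y hx hy => rw [map_add, map_add, hx, hy]

/-- Restriction of polynomial functions to a subspace. -/
def restrict (H : Submodule K V) : CoordRing K V →ₐ[K] CoordRing K H :=
  lift (ι K (Dual K H) ∘ₗ H.dualRestrict)

lemma restrict_ι (H : Submodule K V) (β : Dual K V) :
    restrict H (ι K _ β) = ι K _ (β ∘ₗ H.subtype) := by
  rw [restrict, lift_ι_apply]
  rfl

lemma dualRestrict_eq_zero_iff {α β : Dual K V} (hα : α ≠ 0) :
    β ∘ₗ (LinearMap.ker α).subtype = 0 ↔ ∃ c : K, β = c • α := by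
  constructor
  · intro h
    obtain ⟨v, hv⟩ : ∃ v, α v ≠ 0 := by
      by_contra! h0
      exact hα (LinearMap.ext h0)
    refine ⟨β v / α v, LinearMap.ext fun w => ?_⟩
    have h1 : w - (α w / α v) • v ∈ LinearMap.ker α := by
      simp [hv]
    have h2 := LinearMap.congr_fun h ⟨_, h1⟩
    simp only [LinearMap.comp_apply, Submodule.subtype_apply, map_sub, map_smul, smul_eq_mul,
      LinearMap.zero_apply] at h2
    simp only [LinearMap.smul_apply, smul_eq_mul]
    field_simp at h2 ⊢
    linear_combination h2
  · rintro ⟨c, rfl⟩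
    ext ⟨x, hx⟩
    simp [LinearMap.mem_ker.1 hx]

/-- Extension of linear forms from a subspace to the whole space. -/
lemma exists_dualRestrict_section (H : Submodule K V) :
    ∃ s : Dual K H →ₗ[K] Dual K V, ∀ γ, s γ ∘ₗ H.subtype = γ := by
  obtain ⟨s, hs⟩ := H.dualRestrict.exists_rightInverse_of_surjective
    (LinearMap.range_eq_top.2 Subspace.dualRestrict_surjective)
  exact ⟨s, fun γ => LinearMap.congr_fun hs γ⟩

lemma restrict_surjective (H : Submodule K V) : Function.Surjective (restrict H) := by
  obtain ⟨s, hs⟩ := exists_dualRestrict_section H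
  intro x
  refine ⟨lift (ι K _ ∘ₗ s) x, ?_⟩
  have : (restrict H).comp (lift (ι K _ ∘ₗ s)) = AlgHom.id K _ := by
    ext γ
    change restrict H (lift (ι K _ ∘ₗ s) (ι K _ γ)) = ι K _ γ
    rw [lift_ι_apply, LinearMap.comp_apply, restrict_ι, hs]
  exact DFunLike.congr_fun this x

lemma restrict_eq_zero_iff {α : Dual K V} (hα : α ≠ 0) (x : CoordRing K V) :
    restrict (LinearMap.ker α) x = 0 ↔ ι K _ α ∣ x := by
  constructor
  · intro hx
    obtain ⟨s, hs⟩ := exists_dualRestrict_section (LinearMap.ker α)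
    have h : ((Ideal.Quotient.mkₐ K (Ideal.span {ι K _ α})).comp
        (lift (ι K _ ∘ₗ s))).comp (restrict (LinearMap.ker α)) =
        Ideal.Quotient.mkₐ K (Ideal.span {ι K _ α}) := by
      ext β
      change Ideal.Quotient.mkₐ K (Ideal.span {ι K _ α})
        (lift (ι K _ ∘ₗ s) (restrict (LinearMap.ker α) (ι K _ β))) =
        Ideal.Quotient.mkₐ K (Ideal.span {ι K _ α}) (ι K _ β)
      rw [restrict_ι, lift_ι_apply, LinearMap.comp_apply]
      obtain ⟨c, hc⟩ := (dualRestrict_eq_zero_iff hα (β := β - s (β ∘ₗ Submodule.subtype _))).1 (by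
        rw [LinearMap.sub_comp, hs, sub_self])
      rw [eq_comm, ← sub_eq_zero, ← map_sub, ← map_sub, hc, Ideal.Quotient.mkₐ_eq_mk,
        Ideal.Quotient.eq_zero_iff_mem, Ideal.mem_span_singleton, map_smul, Algebra.smul_def]
      exact dvd_mul_left _ _
    have h2 := DFunLike.congr_fun h x
    rw [AlgHom.comp_apply, hx, map_zero, eq_comm, Ideal.Quotient.mkₐ_eq_mk,
      Ideal.Quotient.eq_zero_iff_mem, Ideal.mem_span_singleton] at h2
    exact h2
  · rintro ⟨y, rfl⟩
    rw [map_mul, restrict_ι, (dualRestrict_eq_zero_iff hα).2 ⟨1, (one_smul K α).symm⟩, map_zero,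
      zero_mul]

lemma ι_eq_zero_iff {α : Dual K V} : ι K (Dual K V) α = 0 ↔ α = 0 := by
  refine ⟨fun h => ?_, fun h => by rw [h, map_zero]⟩
  by_contra h0
  obtain ⟨v, hv⟩ : ∃ v, α v ≠ 0 := by
    by_contra! h1
    exact h0 (LinearMap.ext h1)
  have := congrArg (lift (Dual.eval K V v)) h
  rw [lift_ι_apply, map_zero] at this
  exact hv this

lemma not_isUnit_ι (α : Dual K V) : ¬ IsUnit (ι K (Dual K V) α) := fun h => by
  have := h.map (algebraMapInv (R := K) (M := Dual K V))
  rw [algebraMapInv_ι] at this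
  exact not_isUnit_zero this

lemma prime_ι {α : Dual K V} (hα : α ≠ 0) : Prime (ι K (Dual K V) α) := by
  refine ⟨fun h => hα (ι_eq_zero_iff.1 h), not_isUnit_ι α, fun a b hab => ?_⟩
  rw [← restrict_eq_zero_iff hα, map_mul, mul_eq_zero] at hab
  rwa [restrict_eq_zero_iff hα, restrict_eq_zero_iff hα] at hab

lemma ι_dvd_ι_iff {α β : Dual K V} (hα : α ≠ 0) :
    ι K (Dual K V) α ∣ ι K _ β ↔ ∃ c : K, β = c • α := by
  rw [← restrict_eq_zero_iff hα, restrict_ι, ι_eq_zero_iff, dualRestrict_eq_zero_iff hα]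

lemma eq_smul_of_ker_eq {α β : Dual K V} (hα : α ≠ 0)
    (h : LinearMap.ker α = LinearMap.ker β) : ∃ c : K, β = c • α := by
  rw [← dualRestrict_eq_zero_iff hα]
  ext ⟨x, hx⟩
  rw [h] at hx
  exact hx

lemma restrict_mem_pow (H : Submodule K V) {x : CoordRing K V} {n : ℕ}
    (hx : x ∈ LinearMap.range (ι K (Dual K V)) ^ n) :
    restrict H x ∈ LinearMap.range (ι K (Dual K H)) ^ n := by
  have h : (LinearMap.range (ι K (Dual K V)) ^ n).map (restrict H).toLinearMap ≤
      LinearMap.range (ι K (Dual K H)) ^ n := by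
    rw [Submodule.map_pow]
    gcongr
    rintro _ ⟨_, ⟨β, rfl⟩, rfl⟩
    exact ⟨_, (restrict_ι H β).symm⟩
  exact h ⟨x, hx, rfl⟩

lemma map_equivMvPolynomial_pow {τ : Type*} (c : Basis τ K (Dual K V)) (n : ℕ) :
    (LinearMap.range (ι K (Dual K V)) ^ n).map (equivMvPolynomial c).toAlgHom.toLinearMap =
      MvPolynomial.homogeneousSubmodule τ K n := by
  rw [Submodule.map_pow, ← MvPolynomial.homogeneousSubmodule_one_pow]
  congr 1
  rw [MvPolynomial.homogeneousSubmodule_one_eq_span_X, ← LinearMap.range_comp,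
    ← Submodule.map_top, ← c.span_eq, Submodule.map_span, ← Set.range_comp]
  congr 2
  ext1 i
  exact equivMvPolynomial_ι_apply c i

lemma mem_pow_iff_isHomogeneous {τ : Type*} (c : Basis τ K (Dual K V)) (n : ℕ)
    (x : CoordRing K V) : x ∈ LinearMap.range (ι K (Dual K V)) ^ n ↔
      (equivMvPolynomial c x).IsHomogeneous n := by
  rw [← MvPolynomial.mem_homogeneousSubmodule, ← map_equivMvPolynomial_pow c]
  constructor
  · intro h
    exact ⟨x, h, rfl⟩
  · rintro ⟨y, hy, hyx⟩
    rwa [← (equivMvPolynomial c).injective hyx]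

variable [FiniteDimensional K V]

instance : UniqueFactorizationMonoid (CoordRing K V) :=
  (equivMvPolynomial (finBasis K (Dual K V))).symm.toMulEquiv.uniqueFactorizationMonoid
    inferInstance

omit [FiniteDimensional K V] in
lemma exists_derivation (g : Dual K V →ₗ[K] CoordRing K V) :
    ∃ θ : Derivation K (CoordRing K V) (CoordRing K V), ∀ α, θ (ι K _ α) = g α := by
  let b := Basis.ofVectorSpace K (Dual K V)
  let e := equivMvPolynomial b
  let D := MvPolynomial.mkDerivation K fun i => e (g (b i))
  let θ : Derivation K (CoordRing K V) (CoordRing K V) :=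
    Derivation.mk' (e.symm.toLinearMap ∘ₗ D.toLinearMap ∘ₗ e.toLinearMap) fun x y => by
      simp
  have h : θ.toLinearMap ∘ₗ ι K _ = g := b.ext fun i => by
    change e.symm (D (e (ι K _ (b i)))) = g (b i)
    rw [equivMvPolynomial_ι_apply, MvPolynomial.mkDerivation_X, e.symm_apply_apply]
  exact ⟨θ, fun α => LinearMap.congr_fun h α⟩

end CoordRing
end HyperplaneArrangement

namespace HyperplaneArrangement

/-! ### Saito's criterion -/

section Saito

variable {K V : Type*} [Field K] [AddCommGroup V] [Module K V]

open SymmetricAlgebra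

/-- A linear form defining the hyperplane `L` of the arrangement `A`; zero if `L` is not in `A`. -/
def form (A : HyperplaneArrangement K V) (L : Submodule K V) : Dual K V :=
  open Classical in if h : L ∈ A.hyperplanes then (A.exists_form L h).choose else 0

lemma form_ne_zero (A : HyperplaneArrangement K V) {L : Submodule K V} (hL : L ∈ A.hyperplanes) :
    A.form L ≠ 0 := by
  rw [form, dif_pos hL]
  exact (A.exists_form L hL).choose_spec.1

lemma ker_form (A : HyperplaneArrangement K V) {L : Submodule K V} (hL : L ∈ A.hyperplanes) :
    LinearMap.ker (A.form L) = L := by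
  rw [form, dif_pos hL]
  exact (A.exists_form L hL).choose_spec.2.symm

lemma not_ι_form_dvd (A : HyperplaneArrangement K V) {L L' : Submodule K V}
    (hL : L ∈ A.hyperplanes) (hL' : L' ∈ A.hyperplanes) (h : L ≠ L') :
    ¬ ι K _ (A.form L) ∣ ι K _ (A.form L') := by
  rw [ι_dvd_ι_iff (A.form_ne_zero hL)]
  rintro ⟨c, hc⟩
  refine h (A.eq_of_le hL hL' ?_)
  rw [← A.ker_form hL, ← A.ker_form hL', hc]
  intro x hx
  rw [LinearMap.mem_ker] at hx ⊢
  simp [hx]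

/-- It suffices to test a derivation on one linear form for every hyperplane. -/
lemma mem_logDer_of_forall_exists (A : HyperplaneArrangement K V)
    {θ : Derivation K (CoordRing K V) (CoordRing K V)}
    (h : ∀ L ∈ A.hyperplanes, ∃ β : Dual K V, β ≠ 0 ∧ LinearMap.ker β = L ∧
      ι K _ β ∣ θ (ι K _ β)) : θ ∈ A.logDer := by
  intro L hL α hα
  obtain ⟨β, hβ0, hβ, y, hy⟩ := h L hL
  obtain ⟨c, rfl⟩ := eq_smul_of_ker_eq hβ0 (hβ.trans hα.symm)
  rw [Ideal.mem_span_singleton, map_smul, Derivation.map_smul]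
  exact ⟨y, by rw [hy, smul_mul_assoc]⟩

lemma mem_logDer_iff (A : HyperplaneArrangement K V)
    (θ : Derivation K (CoordRing K V) (CoordRing K V)) :
    θ ∈ A.logDer ↔ ∀ L ∈ A.hyperplanes, ι K _ (A.form L) ∣ θ (ι K _ (A.form L)) :=
  ⟨fun h L hL => Ideal.mem_span_singleton.1 (h L hL _ (A.ker_form hL)), fun h =>
    A.mem_logDer_of_forall_exists fun L hL => ⟨_, A.form_ne_zero hL, A.ker_form hL, h L hL⟩⟩

/-- The defining polynomial of an arrangement. -/
def defPoly (A : HyperplaneArrangement K V) : CoordRing K V :=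
  ∏ L ∈ A.finite.toFinset, ι K _ (A.form L)

lemma defPoly_ne_zero (A : HyperplaneArrangement K V) : A.defPoly ≠ 0 := by
  refine Finset.prod_ne_zero_iff.2 fun L hL => ?_
  rw [Ne, ι_eq_zero_iff]
  exact A.form_ne_zero (A.finite.mem_toFinset.1 hL)

lemma ι_form_dvd_defPoly (A : HyperplaneArrangement K V) {L : Submodule K V}
    (hL : L ∈ A.hyperplanes) : ι K _ (A.form L) ∣ A.defPoly :=
  Finset.dvd_prod_of_mem _ (A.finite.mem_toFinset.2 hL)

/-- A product of forms defining different hyperplanes divides every common multiple of them. -/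
lemma prod_ι_form_dvd [FiniteDimensional K V] (A : HyperplaneArrangement K V)
    {T : Finset (Submodule K V)} (hT : ∀ L ∈ T, L ∈ A.hyperplanes) {x : CoordRing K V}
    (h : ∀ L ∈ T, ι K _ (A.form L) ∣ x) : ∏ L ∈ T, ι K _ (A.form L) ∣ x := by
  refine Finset.prod_dvd_of_isRelPrime (fun L hL L' hL' hne => ?_) h
  exact (prime_ι (A.form_ne_zero (hT L hL))).irreducible.isRelPrime_iff_not_dvd.2
    (A.not_ι_form_dvd (hT L hL) (hT L' hL') hne)

variable {n : Type*} [Fintype n] [DecidableEq n]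

/-- The matrix of values of derivations on the members of a basis of the space of linear forms. -/
def coeffMatrix (b : Basis n K (Dual K V))
    (η : n → Derivation K (CoordRing K V) (CoordRing K V)) : Matrix n n (CoordRing K V) :=
  Matrix.of fun i j => η i (ι K _ (b j))

/-- The values of a derivation on a basis of the space of linear forms. -/
def coeffVec (b : Basis n K (Dual K V)) :
    Derivation K (CoordRing K V) (CoordRing K V) →ₗ[CoordRing K V] n → CoordRing K V where
  toFun θ j := θ (ι K _ (b j))
  map_add' _ _ := rfl
  map_smul' _ _ := rfl

omit [DecidableEq n] in
lemma derivation_ι_eq_sum (b : Basis n K (Dual K V))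
    (θ : Derivation K (CoordRing K V) (CoordRing K V)) (α : Dual K V) :
    θ (ι K _ α) = ∑ j, algebraMap K _ (b.repr α j) * θ (ι K _ (b j)) := by
  conv_lhs => rw [← b.sum_repr α]
  rw [map_sum, map_sum]
  exact Finset.sum_congr rfl fun j _ => by
    rw [map_smul, Derivation.map_smul, Algebra.smul_def]

omit [DecidableEq n] in
lemma coeffVec_injective (b : Basis n K (Dual K V)) : Function.Injective (coeffVec b) := by
  intro θ₁ θ₂ h
  refine derivation_ext fun α => ?_
  rw [derivation_ι_eq_sum b, derivation_ι_eq_sum b θ₂]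
  exact Finset.sum_congr rfl fun j _ => congrArg _ (congrFun h j)

/-- The determinant of logarithmic derivations is divisible by the defining polynomial. -/
lemma defPoly_dvd_det [FiniteDimensional K V] (A : HyperplaneArrangement K V)
    (b : Basis n K (Dual K V)) {η : n → Derivation K (CoordRing K V) (CoordRing K V)}
    (hη : ∀ i, η i ∈ A.logDer) : A.defPoly ∣ (coeffMatrix b η).det := by
  refine A.prod_ι_form_dvd (fun L hL => A.finite.mem_toFinset.1 hL) fun L hL => ?_
  replace hL := A.finite.mem_toFinset.1 hL
  choose u hu using fun i => (A.mem_logDer_iff (η i)).1 (hη i) L hL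
  set α := A.form L
  obtain ⟨k, hk⟩ : ∃ k, b.repr α k ≠ 0 := by
    by_contra! h
    exact A.form_ne_zero hL (b.repr.map_eq_zero_iff.1 (Finsupp.ext h))
  set c : n → CoordRing K V := fun j => algebraMap K _ (b.repr α j) with hc
  set M := coeffMatrix b η with hM
  have h1 : M.mulVec c = ι K _ α • u := by
    ext1 i
    rw [Pi.smul_apply, smul_eq_mul, ← hu, derivation_ι_eq_sum b]
    exact Finset.sum_congr rfl fun j _ => mul_comm _ _
  have h2 : M.det • c = ι K _ α • M.adjugate.mulVec u := by
    rw [← Matrix.mulVec_smul, ← h1, Matrix.mulVec_mulVec, Matrix.adjugate_mul, Matrix.smul_mulVec,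
      Matrix.one_mulVec]
  have h3 := congrFun h2 k
  rw [Pi.smul_apply, Pi.smul_apply, smul_eq_mul, smul_eq_mul] at h3
  have hunit : IsUnit (c k) := (Ne.isUnit hk).map (algebraMap K (CoordRing K V))
  exact hunit.dvd_mul_right.1 ⟨_, h3⟩

/-- Saito's criterion. -/
lemma exists_basis_of_det_dvd_defPoly [FiniteDimensional K V] (A : HyperplaneArrangement K V)
    (b : Basis n K (Dual K V)) {η : n → Derivation K (CoordRing K V) (CoordRing K V)}
    (hη : ∀ i, η i ∈ A.logDer) (hdet : (coeffMatrix b η).det ∣ A.defPoly) :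
    ∃ B : Basis n (CoordRing K V) A.logDer, ∀ i, (B i : Derivation K _ _) = η i := by
  set M := coeffMatrix b η with hM
  have hM0 : M.det ≠ 0 := fun h => A.defPoly_ne_zero (zero_dvd_iff.1 (h ▸ hdet))
  let η' : n → A.logDer := fun i => ⟨η i, hη i⟩
  have hli : LinearIndependent (CoordRing K V) η' := by
    refine LinearIndependent.of_comp (coeffVec b ∘ₗ A.logDer.subtype) ?_
    exact Matrix.linearIndependent_rows_of_det_ne_zero hM0
  refine ⟨Basis.mk hli ?_, fun i => by rw [Basis.mk_apply]⟩
  rintro ⟨θ, hθ⟩ -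
  have h1 : ∀ k, M.det ∣ M.transpose.cramer (coeffVec b θ) k := by
    intro k
    rw [Matrix.cramer_transpose_apply]
    have h2 : M.updateRow k (coeffVec b θ) = coeffMatrix b (Function.update η k θ) := by
      ext i j
      rcases eq_or_ne i k with rfl | hik
      · simp [coeffMatrix, coeffVec]
      · simp [hM, coeffMatrix, hik]
    rw [h2]
    refine hdet.trans (A.defPoly_dvd_det b fun i => ?_)
    rcases eq_or_ne i k with rfl | hik
    · simpa
    · simpa [hik] using hη i
  choose t ht using h1
  have h3 : ∑ k, t k • η k = θ := by
    apply coeffVec_injective b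
    have h4 : M.det • coeffVec b (∑ k, t k • η k) = M.det • coeffVec b θ := by
      have h5 := Matrix.mulVec_cramer M.transpose (coeffVec b θ)
      rw [Matrix.det_transpose] at h5
      rw [← h5]
      ext1 j
      rw [map_sum, Pi.smul_apply, Finset.sum_apply, smul_eq_mul, Finset.mul_sum]
      refine Finset.sum_congr rfl fun k _ => ?_
      rw [ht, map_smul, Pi.smul_apply, smul_eq_mul]
      change _ = η k (ι K _ (b j)) * _
      change _ * (_ * η k (ι K _ (b j))) = _
      ring
    exact smul_right_injective _ hM0 h4
  have h6 : (⟨θ, hθ⟩ : A.logDer) = ∑ k, t k • η' k := by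
    ext1
    rw [Submodule.coe_sum]
    exact h3.symm
  rw [h6]
  exact Submodule.sum_mem _ fun k _ => Submodule.smul_mem _ _ (Submodule.subset_span ⟨k, rfl⟩)

lemma det_basis_dvd_det (A : HyperplaneArrangement K V) (b : Basis n K (Dual K V))
    (B : Basis n (CoordRing K V) A.logDer)
    {η : n → Derivation K (CoordRing K V) (CoordRing K V)} (hη : ∀ i, η i ∈ A.logDer) :
    (coeffMatrix b fun i => (B i : Derivation K _ _)).det ∣ (coeffMatrix b η).det := by
  have h : coeffMatrix b η = (Matrix.of fun i k => B.repr ⟨η i, hη i⟩ k) *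
      coeffMatrix b fun i => (B i : Derivation K _ _) := by
    ext i j
    have h1 := congrArg (Subtype.val) (B.sum_repr ⟨η i, hη i⟩)
    rw [Submodule.coe_sum] at h1
    have h2 := congrFun (congrArg (coeffVec b) h1) j
    rw [map_sum, Finset.sum_apply] at h2
    exact h2.symm
  rw [h, Matrix.det_mul]
  exact dvd_mul_left _ _

/-- The determinant of a basis of the logarithmic derivations divides the defining polynomial. For a
prime `p` not dividing `Q` this is seen on the derivations `Q ∂ⱼ`, and for `p = α_L` on `Q ∂ₖ` and
derivations `(Q / α_L) ∂` where `∂` kills `α_L`. -/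
lemma det_basis_dvd_defPoly [FiniteDimensional K V] (A : HyperplaneArrangement K V)
    (b : Basis n K (Dual K V)) (B : Basis n (CoordRing K V) A.logDer) :
    (coeffMatrix b fun i => (B i : Derivation K _ _)).det ∣ A.defPoly := by
  set D := (coeffMatrix b fun i => (B i : Derivation K _ _)).det with hD
  have hpow : D ∣ A.defPoly ^ Fintype.card n := by
    choose η hη using fun i => exists_derivation
      ((LinearMap.toSpanSingleton K (CoordRing K V) A.defPoly) ∘ₗ b.coord i)
    have h := A.det_basis_dvd_det b B (η := η) fun i => (A.mem_logDer_iff _).2 fun L hL => by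
      rw [hη]
      exact (A.ι_form_dvd_defPoly hL).trans (by
        simp [LinearMap.toSpanSingleton_apply, Algebra.smul_def])
    have hmat : coeffMatrix b η = Matrix.diagonal fun _ => A.defPoly := by
      ext i j
      simp [coeffMatrix, hη, LinearMap.toSpanSingleton_apply, Finsupp.single_apply,
        Matrix.diagonal_apply, eq_comm]
    rwa [hmat, Matrix.det_diagonal, Finset.prod_const, Finset.card_univ] at h
  have hD0 : D ≠ 0 := fun h => pow_ne_zero _ A.defPoly_ne_zero (zero_dvd_iff.1 (h ▸ hpow))
  refine dvd_of_forall_prime hD0 A.defPoly_ne_zero fun p hp => ?_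
  by_cases hpQ : p ∣ A.defPoly
  · obtain ⟨L, hL, hpL⟩ := (hp.dvd_finsetProd_iff _).1 hpQ
    have hL' := A.finite.mem_toFinset.1 hL
    have hα := A.form_ne_zero hL'
    set α := A.form L with hαdef
    have hassoc := hp.associated_of_dvd (prime_ι hα) hpL
    classical
    set q := ∏ L' ∈ A.finite.toFinset.erase L, ι K _ (A.form L') with hq
    have hpq : ¬ p ∣ q := by
      rw [hp.dvd_finsetProd_iff]
      rintro ⟨L', hL₁, hpL'⟩
      rw [Finset.mem_erase] at hL₁
      exact A.not_ι_form_dvd hL' (A.finite.mem_toFinset.1 hL₁.2) hL₁.1.symm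
        (hassoc.dvd'.trans hpL')
    obtain ⟨k, hk⟩ : ∃ k, b.repr α k ≠ 0 := by
      by_contra! h
      exact hα (b.repr.map_eq_zero_iff.1 (Finsupp.ext h))
    choose η hη using fun i => exists_derivation (if i = k then
        LinearMap.toSpanSingleton K (CoordRing K V) A.defPoly ∘ₗ b.coord k
      else LinearMap.toSpanSingleton K (CoordRing K V) q ∘ₗ
        (b.coord i - (b.repr α i / b.repr α k) • b.coord k))
    have h := A.det_basis_dvd_det b B (η := η) fun i => (A.mem_logDer_iff _).2 fun L₁ hL₁ => by
      rw [hη]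
      split_ifs with hik
      · rw [LinearMap.comp_apply, LinearMap.toSpanSingleton_apply, Algebra.smul_def]
        exact (A.ι_form_dvd_defPoly hL₁).mul_left _
      · rw [LinearMap.comp_apply, LinearMap.toSpanSingleton_apply, Algebra.smul_def]
        by_cases hLL : L₁ = L
        · subst hLL
          have : (b.coord i - (b.repr α i / b.repr α k) • b.coord k) α = 0 := by
            simp [hk]
          rw [← hαdef, this, map_zero, zero_mul]
          exact dvd_zero _
        · exact Dvd.dvd.mul_left (Finset.dvd_prod_of_mem _
            (Finset.mem_erase.2 ⟨hLL, A.finite.mem_toFinset.2 hL₁⟩)) _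
    set T : Matrix n n (CoordRing K V) := Matrix.of fun i j =>
      (1 : Matrix n n (CoordRing K V)) i j +
        (if i = k then 0 else - algebraMap K _ (b.repr α i / b.repr α k)) *
          (1 : Matrix n n (CoordRing K V)) k j with hT
    have hT1 : T.det = 1 := by
      rw [← Matrix.det_one (n := n) (R := CoordRing K V)]
      exact Matrix.det_eq_of_forall_row_eq_smul_add_const
        (fun i => if i = k then 0 else - algebraMap K _ (b.repr α i / b.repr α k)) k
        (if_pos rfl) fun i j => rfl
    have hmat : coeffMatrix b η =
        Matrix.diagonal (fun i => if i = k then A.defPoly else q) * T := by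
      ext i j
      rw [Matrix.diagonal_mul]
      simp only [coeffMatrix, Matrix.of_apply, hη, hT]
      split_ifs with hik
      · subst hik
        simp [LinearMap.toSpanSingleton_apply, Finsupp.single_apply, Matrix.one_apply, eq_comm]
      · simp only [LinearMap.comp_apply, LinearMap.toSpanSingleton_apply, LinearMap.sub_apply,
          LinearMap.smul_apply, Basis.coord_apply, Basis.repr_self, Finsupp.single_apply,
          Matrix.one_apply, Algebra.smul_def, map_sub]
        simp only [eq_comm (a := j)]
        split_ifs <;> simp <;> ring
    rw [hmat, Matrix.det_mul, hT1, mul_one, Matrix.det_diagonal,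
      ← Finset.prod_erase_mul _ _ (Finset.mem_univ k), if_pos rfl] at h
    refine ⟨_, fun hpc => ?_, h⟩
    obtain ⟨i, hi, hpi⟩ := (hp.dvd_finsetProd_iff _).1 hpc
    rw [if_neg (Finset.ne_of_mem_erase hi)] at hpi
    exact hpq hpi
  · exact ⟨A.defPoly ^ Fintype.card n, fun h => hpQ (hp.dvd_of_dvd_pow h), hpow.mul_right _⟩

end Saito
end HyperplaneArrangement

/-! ### Maximal minors of the matrix of relations -/

section Determinant

variable {R κ : Type*} [CommRing R] [UniqueFactorizationMonoid R]
  [Fintype κ] [DecidableEq κ]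

/-- Let `f` be the last column of the square matrix `M`, and let the rows of `W` generate the
relations between the `fᵢ`, so that `W * M` is a square matrix `N` followed by a zero column. The
maximal minors `w` of `W` satisfy `wⱼ det M = fⱼ det N`, and no prime divides all of them: the
`j`-th one divides a power of `fⱼ / g`, where `g` is the greatest common divisor of all `fⱼ`. -/
lemma exists_minor_mul_det_eq (M : Matrix (κ ⊕ Unit) (κ ⊕ Unit) R)
    (hf : (fun i => M i (Sum.inr ())) ≠ 0) {W : κ → κ ⊕ Unit → R}
    (hW : Submodule.span R (Set.range W) = syzygies fun i => M i (Sum.inr ()))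
    {p : R} (hp : Prime p) :
    ∃ (w : R) (j : κ ⊕ Unit), ¬ p ∣ w ∧ w * M.det =
      M j (Sum.inr ()) * (Matrix.of fun k l => ∑ i, W k i * M i (Sum.inl l) : Matrix κ κ R).det := by
  obtain ⟨g, f', hgf, hcop⟩ := exists_common_factor _ hf
  obtain ⟨j, hj⟩ := hcop p hp
  set N : Matrix κ κ R := Matrix.of fun k l => ∑ i, W k i * M i (Sum.inl l) with hN
  set U : Matrix (κ ⊕ Unit) (κ ⊕ Unit) R := Matrix.of (Sum.elim W fun _ => Pi.single j 1) with hU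
  have hWf : ∀ k, ∑ i, W k i * M i (Sum.inr ()) = 0 := fun k => by
    have : W k ∈ syzygies fun i => M i (Sum.inr ()) := hW ▸ Submodule.subset_span ⟨k, rfl⟩
    exact mem_syzygies.1 this
  have hUM : U * M = Matrix.fromBlocks N 0 (Matrix.of fun _ l => M j (Sum.inl l))
      (Matrix.of fun _ _ => M j (Sum.inr ())) := by
    ext (k | k) (l | l)
    · simp [Matrix.mul_apply, hU, hN]
    · simpa [Matrix.mul_apply, hU] using hWf k
    · simp [Matrix.mul_apply, hU, Pi.single_apply]
    · simp [Matrix.mul_apply, hU, Pi.single_apply]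
  refine ⟨U.det, j, fun hpU => ?_, ?_⟩
  -- `T` has the rows `f'ⱼ eᵢ - f'ᵢ eⱼ` for `i ≠ j`, which are relations, and the row `eⱼ`.
  · set T : Matrix (κ ⊕ Unit) (κ ⊕ Unit) R := Matrix.of fun i l =>
      Matrix.diagonal (fun i => if i = j then 1 else f' j) i l +
        (if i = j then 0 else - f' i) *
          Matrix.diagonal (fun i => if i = j then 1 else f' j) j l with hT
    have hTdet : T.det = (Matrix.diagonal (fun i => if i = j then 1 else f' j)).det :=
      Matrix.det_eq_of_forall_row_eq_smul_add_const (fun i => if i = j then 0 else - f' i) j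
        (if_pos rfl) fun i l => rfl
    have hTi : ∀ i, i ≠ j → T i = f' j • Pi.single i 1 - f' i • Pi.single j 1 := by
      intro i hi
      ext l
      simp only [hT, Matrix.of_apply, Matrix.diagonal_apply, if_neg hi, if_true, Pi.sub_apply,
        Pi.smul_apply, Pi.single_apply, smul_eq_mul, eq_comm (a := l)]
      split_ifs <;> simp [sub_eq_add_neg]
    have hTj : T j = Pi.single j 1 := by
      ext l
      simp [hT, Matrix.diagonal_apply, Pi.single_apply, eq_comm]
    have hc : ∀ i, ∃ c : κ ⊕ Unit → R, T i = Matrix.vecMul c U := by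
      intro i
      rcases eq_or_ne i j with rfl | hi
      · refine ⟨Pi.single (Sum.inr ()) 1, ?_⟩
        rw [Matrix.single_one_vecMul, hTj]
        rfl
      · have h1 : T i ∈ syzygies fun i => M i (Sum.inr ()) := by
          rw [hTi i hi, mem_syzygies]
          simp only [hgf, Pi.sub_apply, Pi.smul_apply, Pi.single_apply, smul_eq_mul, sub_mul,
            mul_ite, mul_one, mul_zero, ite_mul, zero_mul, Finset.sum_sub_distrib,
            Finset.sum_ite_eq', Finset.mem_univ, if_true]
          ring
        rw [← hW, Submodule.mem_span_range_iff_exists_fun] at h1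
        obtain ⟨c, hc⟩ := h1
        refine ⟨Sum.elim c 0, ?_⟩
        rw [← hc]
        ext l
        simp [Matrix.vecMul, dotProduct, hU]
    choose C hC using hc
    have hTCU : T = Matrix.of C * U := by
      ext i l
      rw [hC i]
      rfl
    have h2 : p ∣ T.det := by
      rw [hTCU, Matrix.det_mul]
      exact hpU.mul_left _
    rw [hTdet, Matrix.det_diagonal] at h2
    obtain ⟨i, -, hi⟩ := (hp.dvd_finsetProd_iff _).1 h2
    split_ifs at hi
    · exact hp.not_isUnit (isUnit_of_dvd_one hi)
    · exact hj hi
  · rw [← Matrix.det_mul, hUM, Matrix.det_fromBlocks_zero₁₂, Matrix.det_unique (n := Unit), mul_comm]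
    rfl

end Determinant

/-! ### Relations between the values of a basis on the form of `H` -/

namespace HyperplaneArrangement

open SymmetricAlgebra

variable {K V : Type*} [Field K] [AddCommGroup V] [Module K V]

lemma mem_logDer_iff_deletion (A : HyperplaneArrangement K V) {H : Submodule K V}
    (hH : H ∈ A.hyperplanes) (θ : Derivation K (CoordRing K V) (CoordRing K V)) :
    θ ∈ A.logDer ↔ θ ∈ (A.deletion H).logDer ∧ ι K _ (A.form H) ∣ θ (ι K _ (A.form H)) := by
  constructor
  · intro h
    exact ⟨fun L hL α hα => h L hL.1 α hα, (A.mem_logDer_iff θ).1 h H hH⟩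
  · rintro ⟨h, h'⟩
    refine (A.mem_logDer_iff θ).2 fun L hL => ?_
    by_cases hLH : L = H
    · rwa [hLH]
    · exact Ideal.mem_span_singleton.1 (h L ⟨hL, hLH⟩ _ (A.ker_form hL))

lemma restrict_eq_zero_iff_of_ker_eq {α : Dual K V} (hα : α ≠ 0) {H : Submodule K V}
    (h : LinearMap.ker α = H) (x : CoordRing K V) : restrict H x = 0 ↔ ι K _ α ∣ x := by
  subst h
  exact restrict_eq_zero_iff hα x

/-- If the deletion of `H` has the homogeneous basis `θᵢ` and `D(𝒜)` has at most two generators more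
than the dimension of `V`, then the relations between the restrictions of `θᵢ(α_H)` to `H` are
generated by `dim H` homogeneous ones. -/
lemma exists_generators_syzygies_restrict [FiniteDimensional K V] (A : HyperplaneArrangement K V)
    {H : Submodule K V} (hH : H ∈ A.hyperplanes) {o : Type*} [Fintype o]
    (B : Basis o (CoordRing K V) (A.deletion H).logDer) {d : o → ℕ}
    (hB : ∀ i, IsHomogeneousDer (B i : Derivation K (CoordRing K V) (CoordRing K V)) (d i))
    {k : ℕ} (ho : Fintype.card o = k + 1) (hk : 1 ≤ k) (hgen : A.minGen ≤ k + 3)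
    (hf0 : (fun i => restrict H ((B i : Derivation K _ _) (ι K _ (A.form H)))) ≠ 0) :
    ∃ (w : Fin k → o → CoordRing K H) (e : Fin k → ℕ),
      (∀ j i, w j i = 0 ∨ ∃ m, m + d i = e j ∧ w j i ∈ LinearMap.range (ι K (Dual K H)) ^ m) ∧
      Submodule.span (CoordRing K H) (Set.range w) =
        syzygies fun i => restrict H ((B i : Derivation K _ _) (ι K _ (A.form H))) := by
  set α := A.form H with hαdef
  have hα : α ≠ 0 := A.form_ne_zero hH
  set f := fun i => restrict H ((B i : Derivation K _ _) (ι K _ α)) with hf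
  let c := finBasis K (Dual K H)
  let E := equivMvPolynomial c
  let ρ : CoordRing K V →+* MvPolynomial _ K := E.toRingEquiv.toRingHom.comp (restrict H).toRingHom
  have hρ : ∀ x, ρ x = E (restrict H x) := fun x => rfl
  have hρs : Function.Surjective ρ := E.surjective.comp (restrict_surjective H)
  obtain ⟨v, hv⟩ : ∃ v, α v = 1 := LinearMap.surjective hα 1
  obtain ⟨D, hD⟩ := exists_derivation
    ((Algebra.linearMap K (CoordRing K V)) ∘ₗ Dual.eval K V v)
  let δ : CoordRing K V →+ MvPolynomial _ K := ρ.toAddMonoidHom.comp D.toLinearMap.toAddMonoidHom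
  have hδ : ∀ x, δ x = ρ (D x) := fun x => rfl
  obtain ⟨s, hscard, hs⟩ := A.logDer_fg.exists_span_finset_card_eq_spanFinrank
  have hsmem : ∀ θ ∈ s, θ ∈ A.logDer := fun θ hθ => hs ▸ Submodule.subset_span hθ
  let Ψ : (o → CoordRing K V) →ₗ[CoordRing K V] Derivation K (CoordRing K V) (CoordRing K V) :=
    (A.deletion H).logDer.subtype ∘ₗ B.equivFun.symm.toLinearMap
  have hΨinj : Function.Injective Ψ :=
    (A.deletion H).logDer.subtype_injective.comp B.equivFun.symm.injective
  have hΨ : ∀ a, Ψ a = ∑ i, a i • (B i : Derivation K _ _) := by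
    intro a
    simp [Ψ, Basis.equivFun_symm_apply]
  let η : Fin s.card → o → CoordRing K V := fun j =>
    B.equivFun ⟨(s.equivFin.symm j : Derivation K _ _),
      ((A.mem_logDer_iff_deletion hH _).1 (hsmem _ (s.equivFin.symm j).2)).1⟩
  have hΨη : ∀ j, Ψ (η j) = s.equivFin.symm j := by
    intro j
    simp [Ψ, η]
  have hmap : (Submodule.span (CoordRing K V) (Set.range η)).map Ψ = A.logDer := by
    rw [Submodule.map_span, ← hs, ← Set.range_comp]
    congr 1
    ext θ
    constructor
    · rintro ⟨j, rfl⟩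
      rw [Function.comp_apply, hΨη]
      exact (s.equivFin.symm j).2
    · intro hθ
      exact ⟨s.equivFin ⟨θ, hθ⟩, by rw [Function.comp_apply, hΨη, Equiv.symm_apply_apply]⟩
  -- `ρ + ε δ` is restriction to the first infinitesimal neighbourhood of `H`, as `δ` is the
  -- derivative in a direction `v` transversal to `H`, restricted to `H`.
  obtain ⟨w, e, hw, hspan⟩ := exists_homogeneous_generators_syzygies ρ hρs δ
    (fun x y => by
      simp only [hδ, Derivation.leibniz, map_add, smul_eq_mul, map_mul])
    (x := ι K _ α)
    (by rw [hρ, (restrict_eq_zero_iff_of_ker_eq hα (A.ker_form hH) _).2 dvd_rfl, map_zero])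
    (by rw [hδ, hD]; simp [hv])
    (d := d) (f := fun i => E (f i))
    (fun i => (mem_pow_iff_isHomogeneous c _ _).1 (restrict_mem_pow H (hB i α)))
    (fun h => hf0 (funext fun i => by
      have := congrFun h i
      exact (map_eq_zero_iff E E.injective).1 this))
    ho hk (hscard.trans_le hgen) η (fun a => by
      have h1 : a ∈ Submodule.span (CoordRing K V) (Set.range η) ↔ Ψ a ∈ A.logDer := by
        rw [← hmap, Submodule.mem_map]
        constructor
        · intro h; exact ⟨a, h, rfl⟩
        · rintro ⟨a', h, h'⟩
          rwa [← hΨinj h']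
      have h3 : (∑ i, a i • (B i : Derivation K _ _)) (ι K _ α) =
          ∑ i, a i * (B i : Derivation K _ _) (ι K _ α) := by
        have := congrFun (map_sum Derivation.coeFnAddMonoidHom
          (fun i => a i • (B i : Derivation K (CoordRing K V) (CoordRing K V))) Finset.univ)
          (ι K _ α)
        rw [Finset.sum_apply] at this
        exact this
      have h2 : Ψ a ∈ (A.deletion H).logDer := (B.equivFun.symm a).2
      rw [h1, A.mem_logDer_iff_deletion hH, and_iff_right h2,
        ← restrict_eq_zero_iff_of_ker_eq hα (A.ker_form hH), ← map_eq_zero_iff E E.injective, hΨ,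
        h3, map_sum, map_sum]
      simp only [hρ, hf, map_mul])
  refine ⟨fun j i => E.symm (w j i), e, fun j i => ?_, ?_⟩
  · have h := congrFun (hw j) i
    rw [MvPolynomial.shiftedComponent_apply] at h
    split_ifs at h with hd
    · refine Or.inr ⟨e j - d i, Nat.sub_add_cancel hd, ?_⟩
      rw [mem_pow_iff_isHomogeneous c]
      change (E (E.symm (w j i))).IsHomogeneous _
      rw [E.apply_symm_apply, ← h]
      exact MvPolynomial.homogeneousComponent_isHomogeneous _ _
    · left
      change E.symm (w j i) = 0
      rw [← h, map_zero]
  · ext a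
    have h1 : a ∈ syzygies f ↔ (fun i => E (a i)) ∈ syzygies fun i => E (f i) := by
      rw [mem_syzygies, mem_syzygies, ← map_eq_zero_iff E E.injective, map_sum]
      simp only [map_mul]
    rw [h1, ← hspan, Submodule.mem_span_range_iff_exists_fun,
      Submodule.mem_span_range_iff_exists_fun]
    constructor
    · rintro ⟨t, rfl⟩
      refine ⟨fun j => E (t j), ?_⟩
      ext1 i
      simp [Finset.sum_apply]
    · rintro ⟨t, ht⟩
      refine ⟨fun j => E.symm (t j), ?_⟩
      ext1 i
      apply E.injective
      rw [← congrFun ht i]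
      simp [Finset.sum_apply]

end HyperplaneArrangement

/-! ### Freeness of the restriction -/

namespace HyperplaneArrangement

open SymmetricAlgebra

variable {K V : Type*} [Field K] [AddCommGroup V] [Module K V]

/-- A basis of the linear forms on a hyperplane lifts to a basis of all linear forms, together with
a form defining the hyperplane. -/
lemma exists_basis_extending [FiniteDimensional K V] {α : Dual K V} (hα : α ≠ 0)
    {H : Submodule K V} (h : LinearMap.ker α = H) {κ : Type*} [Fintype κ]
    (c : Basis κ K (Dual K H)) :
    ∃ b : Basis (κ ⊕ Unit) K (Dual K V), b (Sum.inr ()) = α ∧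
      ∀ k, b (Sum.inl k) ∘ₗ H.subtype = c k := by
  subst h
  obtain ⟨s, hs⟩ := exists_dualRestrict_section (LinearMap.ker α)
  let u : κ ⊕ Unit → Dual K V := Sum.elim (fun k => s (c k)) fun _ => α
  have hspan : ⊤ ≤ Submodule.span K (Set.range u) := by
    rintro β -
    obtain ⟨t, ht⟩ := (dualRestrict_eq_zero_iff hα (β := β - s (β ∘ₗ Submodule.subtype _))).1 (by
      rw [LinearMap.sub_comp, hs, sub_self])
    rw [← sub_add_cancel β (s (β ∘ₗ Submodule.subtype _)), ht, ← c.sum_repr (β ∘ₗ _), map_sum]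
    refine Submodule.add_mem _ (Submodule.smul_mem _ _ (Submodule.subset_span ⟨Sum.inr (), rfl⟩))
      (Submodule.sum_mem _ fun k _ => ?_)
    rw [map_smul]
    exact Submodule.smul_mem _ _ (Submodule.subset_span ⟨Sum.inl k, rfl⟩)
  have hcard : Fintype.card (κ ⊕ Unit) = finrank K (Dual K V) := by
    rw [Fintype.card_sum, Fintype.card_unit, ← finrank_eq_card_basis c,
      Subspace.dual_finrank_eq, Subspace.dual_finrank_eq, Dual.finrank_ker_add_one_of_ne_zero hα]
  refine ⟨basisOfTopLeSpanOfCardEqFinrank u hspan hcard, ?_, fun k => ?_⟩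
  · rw [coe_basisOfTopLeSpanOfCardEqFinrank]
    rfl
  · rw [coe_basisOfTopLeSpanOfCardEqFinrank]
    exact hs (c k)

/-- The restriction to `H` of a form defining a hyperplane other than `H` is not zero. -/
lemma form_deletion_comp_ne_zero (A : HyperplaneArrangement K V) {H : Submodule K V}
    (hH : H ∈ A.hyperplanes) {L : Submodule K V} (hL : L ∈ (A.deletion H).hyperplanes) :
    (A.deletion H).form L ∘ₗ H.subtype ≠ 0 := by
  intro h
  refine hL.2 (A.eq_of_le hH hL.1 fun x hx => ?_).symm
  rw [← (A.deletion H).ker_form hL]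
  exact LinearMap.congr_fun h ⟨x, hx⟩

lemma ker_form_deletion_comp (A : HyperplaneArrangement K V) {H : Submodule K V}
    {L : Submodule K V} (hL : L ∈ (A.deletion H).hyperplanes) :
    LinearMap.ker ((A.deletion H).form L ∘ₗ H.subtype) = L.comap H.subtype := by
  rw [LinearMap.ker_comp, (A.deletion H).ker_form hL]

/-- Let `θ` be logarithmic for the deletion of `H = ker α`, and let `T` be a set of hyperplanes
having the same intersection with `H` as the hyperplane `ker β`. Then the product of the forms
of `T` divides, on `H`, the product of `β` and `θ(α)`. Indeed it divides `α θ(β) - β θ(α)`: this is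
`α θ(β + c α) - (β + c α) θ(α)` for every `c`, and the forms of `T` are multiples of such
`β + c α`. -/
lemma restrict_prod_dvd [FiniteDimensional K V] (A : HyperplaneArrangement K V) {H : Submodule K V}
    (hH : H ∈ A.hyperplanes) {L : Submodule K V} (hL : L ∈ (A.deletion H).hyperplanes)
    {T : Finset (Submodule K V)} (hT : ∀ L' ∈ T, L' ∈ (A.deletion H).hyperplanes ∧
      L'.comap H.subtype = L.comap H.subtype)
    {θ : Derivation K (CoordRing K V) (CoordRing K V)} (hθ : θ ∈ (A.deletion H).logDer) :
    restrict H (∏ L' ∈ T, ι K _ ((A.deletion H).form L')) ∣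
      restrict H (ι K _ ((A.deletion H).form L)) * restrict H (θ (ι K _ (A.form H))) := by
  set α := A.form H with hαdef
  set β := (A.deletion H).form L with hβdef
  have hα : α ≠ 0 := A.form_ne_zero hH
  have h : ∏ L' ∈ T, ι K _ ((A.deletion H).form L') ∣
      ι K _ α * θ (ι K _ β) - ι K _ β * θ (ι K _ α) := by
    refine (A.deletion H).prod_ι_form_dvd (fun L' hL' => (hT L' hL').1) fun L' hL' => ?_
    obtain ⟨hL'A, hLL'⟩ := hT L' hL'
    have hlog := ((A.deletion H).mem_logDer_iff θ).1 hθ L' hL'A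
    set γ := (A.deletion H).form L' with hγdef
    obtain ⟨a, ha⟩ := eq_smul_of_ker_eq (A.form_deletion_comp_ne_zero hH hL'A)
      (β := β ∘ₗ H.subtype)
      (by rw [ker_form_deletion_comp _ hL'A, ker_form_deletion_comp _ hL, hLL'])
    obtain ⟨t, ht⟩ : ∃ t : K, β - a • γ = t • α := by
      have hker := A.ker_form hH
      rw [← dualRestrict_eq_zero_iff hα]
      ext ⟨x, hx⟩
      rw [hker] at hx
      have := LinearMap.congr_fun ha ⟨x, hx⟩
      simp only [LinearMap.comp_apply, Submodule.subtype_apply, LinearMap.smul_apply,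
        LinearMap.sub_apply, LinearMap.zero_apply] at this ⊢
      rw [sub_eq_zero]
      exact this
    rw [sub_eq_iff_eq_add] at ht
    obtain ⟨y, hy⟩ := hlog
    rw [ht, map_add, map_smul, map_smul, map_add, Derivation.map_smul, Derivation.map_smul, hy]
    refine ⟨a • (ι K _ α * y - θ (ι K _ α)), ?_⟩
    simp only [Algebra.smul_def]
    ring
  have h2 := map_dvd (restrict H) h
  rw [map_sub, map_mul, map_mul, (restrict_eq_zero_iff_of_ker_eq hα (A.ker_form hH) _).2 dvd_rfl,
    zero_mul, zero_sub, dvd_neg] at h2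
  exact h2

lemma restrict_defPoly_deletion_ne_zero [FiniteDimensional K V] (A : HyperplaneArrangement K V)
    {H : Submodule K V} (hH : H ∈ A.hyperplanes) : restrict H (A.deletion H).defPoly ≠ 0 := by
  rw [defPoly, map_prod]
  refine Finset.prod_ne_zero_iff.2 fun L hL => ?_
  rw [restrict_ι, Ne, ι_eq_zero_iff]
  exact A.form_deletion_comp_ne_zero hH ((A.deletion H).finite.mem_toFinset.1 hL)

/-- Up to a factor prime to `p`, the defining polynomial of the deletion restricts to the product of
a divisor `γ` of the defining polynomial of the restriction and a common factor of all `θ(α_H)`. -/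
lemma exists_factor_restrict_defPoly [FiniteDimensional K V] (A : HyperplaneArrangement K V)
    {H : Submodule K V} (hH : H ∈ A.hyperplanes) {p : CoordRing K H} (hp : Prime p) :
    ∃ P c γ : CoordRing K H, restrict H (A.deletion H).defPoly = P * c ∧ P ≠ 0 ∧ ¬ p ∣ c ∧
      γ ∣ (A.restriction H hH).defPoly ∧ ∀ θ ∈ (A.deletion H).logDer,
        P ∣ γ * restrict H (θ (ι K _ (A.form H))) := by
  classical
  by_cases hpQ : p ∣ restrict H (A.deletion H).defPoly
  -- `p` is the restriction of the form of some `L`; the factor `P` collects the hyperplanes having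
  -- the same intersection with `H` as `L`.
  · have hpQ' := hpQ
    rw [defPoly, map_prod] at hpQ'
    obtain ⟨L, hL, hpL⟩ := (hp.dvd_finsetProd_iff _).1 hpQ'
    rw [Set.Finite.mem_toFinset] at hL
    have hne := A.form_deletion_comp_ne_zero hH hL
    have hker := A.ker_form_deletion_comp hL
    set T := (A.deletion H).finite.toFinset.filter
      fun L' => L'.comap H.subtype = L.comap H.subtype with hT
    set T' := (A.deletion H).finite.toFinset.filter
      fun L' => ¬ L'.comap H.subtype = L.comap H.subtype with hT'
    have hprod : restrict H (A.deletion H).defPoly =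
        restrict H (∏ L' ∈ T, ι K _ ((A.deletion H).form L')) *
          restrict H (∏ L' ∈ T', ι K _ ((A.deletion H).form L')) := by
      rw [← map_mul, Finset.prod_filter_mul_prod_filter_not]
      rfl
    refine ⟨_, _, restrict H (ι K _ ((A.deletion H).form L)), hprod, fun h0 => ?_, fun hpc => ?_,
      ?_, fun θ hθ => A.restrict_prod_dvd hH hL (fun L' hL' => ?_) hθ⟩
    · rw [h0, zero_mul] at hprod
      exact A.restrict_defPoly_deletion_ne_zero hH hprod
    · rw [map_prod] at hpc
      obtain ⟨L', hL', hpL'⟩ := (hp.dvd_finsetProd_iff _).1 hpc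
      rw [hT', Finset.mem_filter, Set.Finite.mem_toFinset] at hL'
      rw [restrict_ι] at hpL hpL'
      have hdvd := (hp.associated_of_dvd (prime_ι hne) hpL).dvd'.trans hpL'
      rw [ι_dvd_ι_iff hne] at hdvd
      obtain ⟨a, ha⟩ := hdvd
      have ha0 : a ≠ 0 := by
        rintro rfl
        rw [zero_smul] at ha
        exact A.form_deletion_comp_ne_zero hH hL'.1 ha
      refine hL'.2 ?_
      rw [← hker, ← A.ker_form_deletion_comp hL'.1, ha, LinearMap.ker_smul _ _ ha0]
    · have hX : L.comap H.subtype ∈ (A.restriction H hH).hyperplanes := ⟨L, hL, rfl⟩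
      rw [restrict_ι]
      refine Dvd.dvd.trans ?_ ((A.restriction H hH).ι_form_dvd_defPoly hX)
      rw [ι_dvd_ι_iff hne]
      exact eq_smul_of_ker_eq hne (hker.trans ((A.restriction H hH).ker_form hX).symm)
    · rw [hT, Finset.mem_filter, Set.Finite.mem_toFinset] at hL'
      exact hL'
  · exact ⟨1, _, 1, (one_mul _).symm, one_ne_zero, hpQ, one_dvd _, fun _ _ => one_dvd _⟩

/-- Let `θᵢ` be a homogeneous basis of the logarithmic derivations of the deletion of `H`. If the
relations between the `θᵢ(α_H)` on `H` have `dim H` homogeneous generators `w`, then the restriction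
is free: the combinations of the `θᵢ` with coefficients `w` induce derivations of the coordinate
ring of `H` that satisfy Saito's criterion. -/
lemma isFree_restriction_of_generators [FiniteDimensional K V] (A : HyperplaneArrangement K V)
    {H : Submodule K V} (hH : H ∈ A.hyperplanes) (hpos : 0 < finrank K H)
    (B : Basis (Fin (finrank K H) ⊕ Unit) (CoordRing K V) (A.deletion H).logDer)
    {d : Fin (finrank K H) ⊕ Unit → ℕ}
    (hB : ∀ i, IsHomogeneousDer (B i : Derivation K (CoordRing K V) (CoordRing K V)) (d i))
    (hf : (fun i => restrict H ((B i : Derivation K _ _) (ι K _ (A.form H)))) ≠ 0)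
    {w : Fin (finrank K H) → Fin (finrank K H) ⊕ Unit → CoordRing K H}
    {e : Fin (finrank K H) → ℕ}
    (hw : ∀ j i, w j i = 0 ∨
      ∃ m, m + d i = e j ∧ w j i ∈ LinearMap.range (ι K (Dual K H)) ^ m)
    (hspan : Submodule.span (CoordRing K H) (Set.range w) =
      syzygies fun i => restrict H ((B i : Derivation K _ _) (ι K _ (A.form H)))) :
    (A.restriction H hH).IsFree := by
  set α := A.form H with hαdef
  have hα : α ≠ 0 := A.form_ne_zero hH
  have hkerα : LinearMap.ker α = H := A.ker_form hH
  let c : Basis (Fin (finrank K H)) K (Dual K H) := finBasisOfFinrankEq K _ Subspace.dual_finrank_eq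
  obtain ⟨b, hbα, hbc⟩ := exists_basis_extending hα hkerα c
  obtain ⟨s, hs⟩ := exists_dualRestrict_section H
  -- `∑ i, w k i θᵢ` kills `α`, hence it descends to the coordinate ring of `H`.
  choose ψ hψ using fun k => exists_derivation (∑ i, LinearMap.mulLeft K (w k i) ∘ₗ
    (restrict H).toLinearMap ∘ₗ (B i : Derivation K _ _).toLinearMap ∘ₗ ι K _ ∘ₗ s)
  replace hψ : ∀ k γ, ψ k (ι K _ γ) =
      ∑ i, w k i * restrict H ((B i : Derivation K _ _) (ι K _ (s γ))) := by
    intro k γ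
    rw [hψ, LinearMap.sum_apply]
    rfl
  have hwf : ∀ k, ∑ i, w k i * restrict H ((B i : Derivation K _ _) (ι K _ α)) = 0 := by
    intro k
    have : w k ∈ syzygies fun i => restrict H ((B i : Derivation K _ _) (ι K _ α)) :=
      hspan ▸ Submodule.subset_span ⟨k, rfl⟩
    exact mem_syzygies.1 this
  have hψβ : ∀ k (β : Dual K V), ψ k (ι K _ (β ∘ₗ H.subtype)) =
      ∑ i, w k i * restrict H ((B i : Derivation K _ _) (ι K _ β)) := by
    intro k β
    obtain ⟨t, ht⟩ : ∃ t : K, s (β ∘ₗ H.subtype) - β = t • α := by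
      rw [← dualRestrict_eq_zero_iff hα]
      ext ⟨x, hx⟩
      rw [hkerα] at hx
      have := LinearMap.congr_fun (hs (β ∘ₗ H.subtype)) ⟨x, hx⟩
      simp only [LinearMap.comp_apply, Submodule.subtype_apply,
        LinearMap.sub_apply, LinearMap.zero_apply] at this ⊢
      rw [sub_eq_zero]
      exact this
    rw [hψ, ← sub_eq_zero, ← Finset.sum_sub_distrib]
    have h1 : ∀ i, w k i * restrict H ((B i : Derivation K _ _) (ι K _ (s (β ∘ₗ H.subtype)))) -
        w k i * restrict H ((B i : Derivation K _ _) (ι K _ β)) =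
        t • (w k i * restrict H ((B i : Derivation K _ _) (ι K _ α))) := by
      intro i
      rw [← mul_sub, ← map_sub, ← map_sub, ← map_sub, ht, map_smul, Derivation.map_smul, map_smul,
        mul_smul_comm]
    simp only [h1]
    rw [← Finset.smul_sum, hwf, smul_zero]
  have hψlog : ∀ k, ψ k ∈ (A.restriction H hH).logDer := by
    intro k
    refine (A.restriction H hH).mem_logDer_of_forall_exists ?_
    rintro _ ⟨L, hL, rfl⟩
    refine ⟨_, A.form_deletion_comp_ne_zero hH hL, A.ker_form_deletion_comp hL, ?_⟩
    rw [hψβ, ← restrict_ι]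
    exact Finset.dvd_sum fun i _ => Dvd.dvd.mul_left (map_dvd (restrict H)
      (((A.deletion H).mem_logDer_iff _).1 (B i).2 L hL)) _
  set M := coeffMatrix b fun i => (B i : Derivation K _ _) with hM
  set M' : Matrix _ _ (CoordRing K H) := (restrict H).toRingHom.mapMatrix M with hM'
  have hM'inr : (fun i => M' i (Sum.inr ())) =
      fun i => restrict H ((B i : Derivation K _ _) (ι K _ α)) := by
    funext i
    rw [← hbα]
    rfl
  have hdetM' : M'.det ∣ restrict H (A.deletion H).defPoly := by
    have h := map_dvd (restrict H).toRingHom ((A.deletion H).det_basis_dvd_defPoly b B)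
    rw [RingHom.map_det] at h
    exact h
  have hM'0 : M'.det ≠ 0 := fun h =>
    A.restrict_defPoly_deletion_ne_zero hH (zero_dvd_iff.1 (h ▸ hdetM'))
  have hN : coeffMatrix c ψ = Matrix.of fun k l => ∑ i, w k i * M' i (Sum.inl l) := by
    ext k l
    change ψ k (ι K _ (c l)) = _
    rw [← hbc, hψβ]
    rfl
  have hminor : ∀ p : CoordRing K H, Prime p → ∃ x j, ¬ p ∣ x ∧ x * M'.det =
      restrict H ((B j : Derivation K _ _) (ι K _ α)) * (coeffMatrix c ψ).det := by
    intro p hp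
    obtain ⟨x, j, hx, h⟩ := exists_minor_mul_det_eq M' (hM'inr ▸ hf) (hM'inr ▸ hspan) hp
    rw [← hN, congrFun hM'inr j] at h
    exact ⟨x, j, hx, h⟩
  have hN0 : (coeffMatrix c ψ).det ≠ 0 := by
    intro h0
    obtain ⟨x, j, hx, h⟩ := hminor _ (prime_ι (c.ne_zero ⟨0, hpos⟩))
    rw [h0, mul_zero] at h
    exact hx ((mul_eq_zero.1 h).resolve_right hM'0 ▸ dvd_zero _)
  obtain ⟨C, hC⟩ := (A.restriction H hH).exists_basis_of_det_dvd_defPoly c hψlog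
    (dvd_of_forall_prime hN0 (A.restriction H hH).defPoly_ne_zero fun p hp => by
      obtain ⟨x, j, hx, h⟩ := hminor p hp
      obtain ⟨P, q, γ, hPq, hP0, hpq, hγ, hPγ⟩ := A.exists_factor_restrict_defPoly hH hp
      obtain ⟨t, ht⟩ := hdetM'
      obtain ⟨r, hr⟩ := hPγ _ (B j).2
      refine ⟨x * q, hp.not_dvd_mul hx hpq, Dvd.dvd.trans ⟨r * t, ?_⟩ (mul_dvd_mul_left _ hγ)⟩
      refine mul_left_cancel₀ hP0 ?_
      rw [hPq] at ht
      linear_combination (x * γ) * ht + (γ * t) * h + (coeffMatrix c ψ).det * t * hr)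
  refine ⟨e, C, fun k γ => ?_⟩
  rw [hC, hψ]
  refine Submodule.sum_mem _ fun i _ => ?_
  rcases hw k i with h0 | ⟨m, hm, hwm⟩
  · rw [h0, zero_mul]
    exact Submodule.zero_mem _
  · rw [← hm, pow_add]
    exact Submodule.mul_mem_mul hwm (restrict_mem_pow H (hB i _))

theorem isFree_restriction [FiniteDimensional K V] (A : HyperplaneArrangement K V)
    {H : Submodule K V} (hH : H ∈ A.hyperplanes) (hdimV : 2 ≤ finrank K V)
    (hfree : (A.deletion H).IsFree) (hgen : A.minGen ≤ finrank K V + 2) :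
    (A.restriction H hH).IsFree := by
  obtain ⟨d, B, hB⟩ := hfree
  have hα := A.form_ne_zero hH
  have hdim : finrank K H + 1 = finrank K V := by
    rw [← Dual.finrank_ker_add_one_of_ne_zero hα, A.ker_form hH]
  let ε : Fin (finrank K V) ≃ Fin (finrank K H) ⊕ Unit :=
    Fintype.equivOfCardEq (by simp [hdim])
  have hB' : ∀ i, IsHomogeneousDer ((B.reindex ε) i :
      Derivation K (CoordRing K V) (CoordRing K V)) (d (ε.symm i)) := fun i => by
    rw [Basis.reindex_apply]
    exact hB _
  obtain ⟨c⟩ : Nonempty (Basis (Fin (finrank K H)) K (Dual K H)) :=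
    ⟨finBasisOfFinrankEq K _ Subspace.dual_finrank_eq⟩
  obtain ⟨b, hb, -⟩ := exists_basis_extending hα (A.ker_form hH) c
  have hf : (fun i => restrict H (((B.reindex ε) i : Derivation K _ _)
      (ι K _ (A.form H)))) ≠ 0 := by
    intro h0
    have h := map_dvd (restrict H).toRingHom
      ((A.deletion H).det_basis_dvd_defPoly b (B.reindex ε))
    rw [RingHom.map_det, Matrix.det_eq_zero_of_column_eq_zero (Sum.inr ()), zero_dvd_iff] at h
    · exact A.restrict_defPoly_deletion_ne_zero hH h
    · intro i
      rw [← hb] at h0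
      exact congrFun h0 i
  obtain ⟨w, e, hw, hspan⟩ := A.exists_generators_syzygies_restrict hH (B.reindex ε) hB'
    (k := finrank K H) (by simp) (by omega) (by omega) hf
  exact A.isFree_restriction_of_generators hH (by omega) (B.reindex ε) hB' hf hw hspan

end HyperplaneArrangement

end

theorem theorem3p7 {K V : Type*} [Field K] [AddCommGroup V] [Module K V] [FiniteDimensional K V]
    (ℓ : ℕ) (hℓ : 3 ≤ ℓ) (hV : Module.finrank K V = ℓ)
    (A : HyperplaneArrangement K V) (H : Submodule K V) (hH : H ∈ A.hyperplanes)
    (hfree : (A.deletion H).IsFree) (hgen : A.minGen ≤ ℓ + 2) :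
    (A.restriction H hH).IsFree :=
  A.isFree_restriction hH (by omega) hfree (by omega)
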